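/- Let $X=(X_n)_{n\ge 0}$ be a real second-order stationary process with covariance sequence $\sigma_X(h)=\mathrm{Cov}(X_0,X_h)$. Suppose that $X$ has a spectral density $f_X\ge 0$ on $[-\pi,\pi]$, that is, $f_X$ is integrable and $\sigma_X(h)=\int_{-\pi}^{\pi}e^{ih\lambda}f_X(\lambda)\,d\lambda$ for all $h\ge 0$, and that $$f_X(\lambda)=|\lambda|^{-2d}\phi(\lambda),\qquad 0<|\lambda|\le\pi,\qquad 0\le d<\tfrac12,$$ where $\phi$ is nonnegative, integrable on $[-\pi,\pi]$ and bounded in a neighbourhood of $0$. Let $T_0=0$ and $T_n=\Delta_1+\dots+\Delta_n$, where the $\Delta_j$ are i.i.d. positive-integer-valued random variables with law $S$, and $(\Delta_j)_{j\ge1}$ is independent of $X$. Put $Y_n=X_{T_n}$ and $\hat S(\lambda)=\sum_{j\ge1}S(j)e^{ij\lambda}$. Assume that $$S(j)\sim c\,j^{-\gamma}\quad(j\to\infty),\qquad c>0,\quad 1<\gamma<2 .$$ Then $Y$ is second-order stationary and has a (nonnegative, integrable) spectral density $f_Y$ on $[-\pi,\pi]$, which for every $\theta\in[-\pi,\pi]$,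 $\theta\ne0$, is given by $$f_Y(\theta)=\lim_{r\to1^-}\frac1{2\pi}\int_{-\pi}^{\pi}f_X(\lambda)\left(\frac1{1-re^{-i\theta}\hat S(\lambda)}+\frac1{1-re^{i\theta}\hat S(\lambda)}-1\right)d\lambda .$$ Moreover, for every such $\theta$ the limit $$G(\theta)=\lim_{r\to1^-}\frac1{4\pi}\int_{-\pi}^{\pi}f_X(\lambda)\left(\frac1{1-re^{-i\theta}\hat S(\lambda)}+\frac1{1-re^{-i\theta}\hat S(-\lambda)}\right)d\lambda$$ exists in $\mathbb C$, $G$ is integrable on $[-\pi,\pi]$, $\sigma_Y(j)=\int_{-\pi}^{\pi}e^{ij\theta}G(\theta)\,d\theta$ for all $j\ge0$, and $f_Y(\theta)=2\,\mathrm{Re}\,G(\theta)-\sigma_X(0)/(2\pi)$. -/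

import Mathlib

open MeasureTheory ProbabilityTheory Filter Topology

noncomputable section

namespace RandomSampling

/-- A real, second order (weakly) stationary process indexed by `ℕ`: finite second moments, constant
mean, and a covariance that depends on the lag only. -/
structure IsSecondOrderStationary {Ω : Type*} [MeasurableSpace Ω] (X : ℕ → Ω → ℝ)
    (μ : Measure Ω) : Prop where
  memLp_two : ∀ n, MemLp (X n) 2 μ
  mean_eq : ∀ n, μ[X n] = μ[X 0]
  cov_eq : ∀ n h, cov[X n, X (n + h); μ] = cov[X 0, X h; μ]

/-- The covariance sequence `σ(h) = Cov(X_0, X_h)`, `h ≥ 0`, of a stationary process. -/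
def covSeq {Ω : Type*} [MeasurableSpace Ω] (X : ℕ → Ω → ℝ) (μ : Measure Ω) (h : ℕ) : ℝ :=
  cov[X 0, X h; μ]

/-- `f` is a spectral density on `[-π, π]` of the process `X`: the process is second order stationary
and its spectral measure is `f(x) dx`. As `X` is real, the lags `h ≥ 0` determine the lags `h < 0`
by complex conjugation. -/
structure HasSpectralDensity {Ω : Type*} [MeasurableSpace Ω] (X : ℕ → Ω → ℝ)
    (μ : Measure Ω) (f : ℝ → ℝ) : Prop where
  stationary : IsSecondOrderStationary X μ
  nonneg : ∀ x ∈ Set.Icc (-Real.pi) Real.pi, 0 ≤ f x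
  integrable : IntervalIntegrable f volume (-Real.pi) Real.pi
  covSeq_eq : ∀ h : ℕ, (covSeq X μ h : ℂ) =
    ∫ x in (-Real.pi)..Real.pi, Complex.exp (Complex.I * (h : ℂ) * (x : ℂ)) * (f x : ℂ)

/-- The random walk `T_0 = 0`, `T_n = Δ_1 + ⋯ + Δ_n`; the steps are numbered from `0` here. -/
def randomWalk {Ω : Type*} (Δ : ℕ → Ω → ℕ) (n : ℕ) (ω : Ω) : ℕ :=
  ∑ j ∈ Finset.range n, Δ j ω

/-- The sampled process `Y_n = X_{T_n}`. -/
def sampled {Ω : Type*} (X : ℕ → Ω → ℝ) (T : ℕ → Ω → ℕ) (n : ℕ) (ω : Ω) : ℝ :=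
  X (T n ω) ω

/-- `Δ` is a sequence of sampling intervals for `X` with common law `S`: positive integer valued,
independent, identically distributed with law `S`, and independent of the process `X`. -/
structure IsSampling {Ω : Type*} [MeasurableSpace Ω] (Δ : ℕ → Ω → ℕ) (S : PMF ℕ)
    (X : ℕ → Ω → ℝ) (μ : Measure Ω) : Prop where
  measurable : ∀ n, Measurable (Δ n)
  law_zero : S 0 = 0
  law_eq : ∀ n, μ.map (Δ n) = S.toMeasure
  iIndep : iIndepFun Δ μ
  indep : IndepFun (fun ω n => X n ω) (fun ω n => Δ n ω) μ

/-- The characteristic function `Ŝ(x) = ∑_j S(j) e^{ijx}` of the sampling law. -/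
def charSeries (S : PMF ℕ) (x : ℝ) : ℂ :=
  ∑' j : ℕ, ((S j).toReal : ℂ) * Complex.exp (Complex.I * (j : ℂ) * (x : ℂ))

/-- `(1/4π) ∫ f(x) (1/(1 - r e^{-iθ} Ŝ(x)) + 1/(1 - r e^{-iθ} Ŝ(-x))) dx`. -/
def oneSidedAbel (f : ℝ → ℝ) (S : PMF ℕ) (r θ : ℝ) : ℂ :=
  (1 / (4 * (Real.pi : ℂ))) * ∫ x in (-Real.pi)..Real.pi, (f x : ℂ) *
    (1 / (1 - (r : ℂ) * Complex.exp (-(Complex.I * (θ : ℂ))) * charSeries S x) +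
      1 / (1 - (r : ℂ) * Complex.exp (-(Complex.I * (θ : ℂ))) * charSeries S (-x)))

/-- `(1/2π) ∫ f(x) (1/(1 - r e^{-iθ} Ŝ(x)) + 1/(1 - r e^{iθ} Ŝ(x)) - 1) dx`. -/
def twoSidedAbel (f : ℝ → ℝ) (S : PMF ℕ) (r θ : ℝ) : ℂ :=
  (1 / (2 * (Real.pi : ℂ))) * ∫ x in (-Real.pi)..Real.pi, (f x : ℂ) *
    (1 / (1 - (r : ℂ) * Complex.exp (-(Complex.I * (θ : ℂ))) * charSeries S x) +
      1 / (1 - (r : ℂ) * Complex.exp (Complex.I * (θ : ℂ)) * charSeries S x) - 1)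

end RandomSampling

end

namespace RandomSampling

/-- Evaluation of a family of functions of `X` at an independent random index `N`. -/
lemma integrable_and_integral_randomIndex {Ω E ι : Type*} [MeasurableSpace Ω] [MeasurableSpace E]
    [MeasurableSpace ι] [Countable ι] [DiscreteMeasurableSpace ι]
    {μ : Measure Ω} [IsProbabilityMeasure μ] {X : Ω → E} {N : Ω → ι} (hX : Measurable X)
    (hN : Measurable N) (hind : IndepFun X N μ) {F : ι → E → ℝ} (hF : ∀ i, Measurable (F i))
    (hint : ∀ i, Integrable (fun ω => F i (X ω)) μ) {C : ℝ}
    (hC : ∀ i, ∫ ω, |F i (X ω)| ∂μ ≤ C) :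
    Integrable (fun ω => F (N ω) (X ω)) μ ∧
      ∫ ω, F (N ω) (X ω) ∂μ = ∫ ω, ∫ ω', F (N ω) (X ω') ∂μ ∂μ := by
  have hFm : Measurable (fun p : E × ι => F p.2 p.1) :=
    measurable_from_prod_countable_left hF
  have hmap := (indepFun_iff_map_prod_eq_prod_map_map hX.aemeasurable hN.aemeasurable).1 hind
  have := Measure.isProbabilityMeasure_map (μ := μ) hX.aemeasurable
  have := Measure.isProbabilityMeasure_map (μ := μ) hN.aemeasurable
  have hXF : ∀ i, Integrable (F i) (μ.map X) := fun i =>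
    (integrable_map_measure (hF i).aestronglyMeasurable hX.aemeasurable).2 (hint i)
  have hprod : Integrable (fun p : E × ι => F p.2 p.1) ((μ.map X).prod (μ.map N)) := by
    rw [integrable_prod_iff' hFm.aestronglyMeasurable]
    refine ⟨Eventually.of_forall fun i => hXF i, ?_⟩
    refine Integrable.of_bound (measurable_of_countable _).aestronglyMeasurable C
      (Eventually.of_forall fun i => ?_)
    rw [Real.norm_of_nonneg (integral_nonneg fun x => norm_nonneg _),
      integral_map hX.aemeasurable (hF i).norm.aestronglyMeasurable]
    exact hC i
  constructor
  · rw [← hmap] at hprod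
    exact (integrable_map_measure hFm.aestronglyMeasurable (hX.prodMk hN).aemeasurable).1 hprod
  · have h1 : ∫ ω, F (N ω) (X ω) ∂μ
        = ∫ p, F p.2 p.1 ∂(μ.map (fun ω => (X ω, N ω))) := by
      rw [integral_map (hX.prodMk hN).aemeasurable hFm.aestronglyMeasurable]
    rw [h1, hmap, integral_prod_symm _ hprod,
      integral_map hN.aemeasurable (measurable_of_countable _).aestronglyMeasurable]
    refine integral_congr_ae (Eventually.of_forall fun ω => ?_)
    exact integral_map hX.aemeasurable (hF _).aestronglyMeasurable

section

variable {Ω : Type*} [MeasurableSpace Ω] {μ : Measure Ω} [IsProbabilityMeasure μ]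
  {X : ℕ → Ω → ℝ}

lemma IsSecondOrderStationary.integral_mul_add (hX : IsSecondOrderStationary X μ) (n h : ℕ) :
    ∫ ω, X n ω * X (n + h) ω ∂μ = covSeq X μ h + μ[X 0] ^ 2 := by
  have := covariance_eq_sub (hX.memLp_two n) (hX.memLp_two (n + h))
  rw [hX.cov_eq, hX.mean_eq n, hX.mean_eq (n + h)] at this
  simp only [Pi.mul_apply] at this
  rw [covSeq, this]
  ring

lemma IsSecondOrderStationary.integral_sq (hX : IsSecondOrderStationary X μ) (n : ℕ) :
    ∫ ω, X n ω ^ 2 ∂μ = covSeq X μ 0 + μ[X 0] ^ 2 := by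
  rw [← hX.integral_mul_add n 0]
  simp [pow_two]

lemma IsSecondOrderStationary.integral_abs_mul_le (hX : IsSecondOrderStationary X μ) (m n : ℕ) :
    ∫ ω, |X m ω * X n ω| ∂μ ≤ covSeq X μ 0 + μ[X 0] ^ 2 := by
  have hm := (hX.memLp_two m).integrable_sq
  have hn := (hX.memLp_two n).integrable_sq
  calc ∫ ω, |X m ω * X n ω| ∂μ ≤ ∫ ω, (1 / 2) * (X m ω ^ 2 + X n ω ^ 2) ∂μ := by
        refine integral_mono ((hX.memLp_two m).integrable_mul (hX.memLp_two n)).abs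
          ((hm.add hn).const_mul _) fun ω => ?_
        simp only [abs_mul]
        nlinarith [sq_nonneg (|X m ω| - |X n ω|), sq_abs (X m ω), sq_abs (X n ω)]
    _ = covSeq X μ 0 + μ[X 0] ^ 2 := by
        rw [integral_const_mul, integral_add hm hn, hX.integral_sq, hX.integral_sq]
        ring

lemma IsSecondOrderStationary.integral_abs_le (hX : IsSecondOrderStationary X μ) (n : ℕ) :
    ∫ ω, |X n ω| ∂μ ≤ 1 + (covSeq X μ 0 + μ[X 0] ^ 2) := by
  have hn := (hX.memLp_two n).integrable_sq
  calc ∫ ω, |X n ω| ∂μ ≤ ∫ ω, (1 + X n ω ^ 2) ∂μ := by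
        refine integral_mono ((hX.memLp_two n).integrable (by norm_num)).abs
          ((integrable_const _).add hn) fun ω => ?_
        simp only
        nlinarith [sq_nonneg (|X n ω| - 1), sq_abs (X n ω)]
    _ = _ := by
        rw [integral_add (integrable_const _) hn, hX.integral_sq]
        simp

variable {Δ : ℕ → Ω → ℕ} {S : PMF ℕ}

lemma measurable_randomWalk (hΔ : ∀ n, Measurable (Δ n)) (n : ℕ) :
    Measurable (randomWalk Δ n) := by
  unfold randomWalk
  fun_prop

omit [MeasurableSpace Ω] in
lemma randomWalk_add (n h : ℕ) (ω : Ω) :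
    randomWalk Δ (n + h) ω = randomWalk Δ n ω + ∑ j ∈ Finset.range h, Δ (n + j) ω := by
  simp [randomWalk, Finset.sum_range_add]

omit [IsProbabilityMeasure μ] in
lemma IsSampling.indepFun_walk (hΔ : IsSampling Δ S X μ) (n h : ℕ) :
    IndepFun (fun ω n => X n ω) (fun ω => (randomWalk Δ n ω, randomWalk Δ (n + h) ω)) μ := by
  have hm : Measurable (fun δ : ℕ → ℕ =>
      (∑ j ∈ Finset.range n, δ j, ∑ j ∈ Finset.range (n + h), δ j)) := by fun_prop
  exact hΔ.indep.comp (φ := id) measurable_id hm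

variable (hXm : ∀ n, Measurable (X n)) (hX : IsSecondOrderStationary X μ)
  (hΔ : IsSampling Δ S X μ)

include hXm hX hΔ

lemma sampled_mul (n h : ℕ) :
    Integrable (fun ω => sampled X (randomWalk Δ) n ω * sampled X (randomWalk Δ) (n + h) ω) μ ∧
    ∫ ω, sampled X (randomWalk Δ) n ω * sampled X (randomWalk Δ) (n + h) ω ∂μ =
      ∫ ω, covSeq X μ (∑ j ∈ Finset.range h, Δ (n + j) ω) ∂μ + μ[X 0] ^ 2 := by
  have key := integrable_and_integral_randomIndex (μ := μ) (X := fun ω n => X n ω)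
    (N := fun ω => (randomWalk Δ n ω, randomWalk Δ (n + h) ω))
    (measurable_pi_lambda _ hXm)
    ((measurable_randomWalk hΔ.measurable n).prodMk (measurable_randomWalk hΔ.measurable _))
    (hΔ.indepFun_walk n h) (F := fun p x => x p.1 * x p.2) (fun p => by fun_prop)
    (fun p => (hX.memLp_two p.1).integrable_mul (hX.memLp_two p.2))
    (C := covSeq X μ 0 + μ[X 0] ^ 2) (fun p => hX.integral_abs_mul_le p.1 p.2)
  refine ⟨key.1, key.2.trans ?_⟩
  simp only [randomWalk_add, hX.integral_mul_add]
  have hm : Measurable (fun ω => ∑ j ∈ Finset.range h, Δ (n + j) ω) := by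
    have := hΔ.measurable
    fun_prop
  rw [integral_add _ (integrable_const _)]
  · simp
  · refine Integrable.of_bound
      ((measurable_of_countable (covSeq X μ)).comp hm).aestronglyMeasurable
      (covSeq X μ 0 + μ[X 0] ^ 2 + μ[X 0] ^ 2) (Eventually.of_forall fun ω => ?_)
    set k := ∑ j ∈ Finset.range h, Δ (n + j) ω
    have h1 := hX.integral_mul_add 0 k
    have h2 := hX.integral_abs_mul_le 0 (0 + k)
    have h3 := abs_integral_le_integral_abs (μ := μ) (f := fun ω => X 0 ω * X (0 + k) ω)
    rw [h1] at h3
    rw [Real.norm_eq_abs, abs_le]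
    have := abs_le.1 (h3.trans h2)
    constructor <;> nlinarith [sq_nonneg (∫ ω, X 0 ω ∂μ)]

lemma sampled_mean (n : ℕ) : ∫ ω, sampled X (randomWalk Δ) n ω ∂μ = μ[X 0] := by
  have key := integrable_and_integral_randomIndex (μ := μ) (X := fun ω n => X n ω)
    (N := fun ω => (randomWalk Δ n ω, randomWalk Δ (n + 0) ω))
    (measurable_pi_lambda _ hXm)
    ((measurable_randomWalk hΔ.measurable n).prodMk (measurable_randomWalk hΔ.measurable _))
    (hΔ.indepFun_walk n 0) (F := fun p x => x p.1) (fun p => by fun_prop)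
    (fun p => (hX.memLp_two p.1).integrable (by norm_num))
    (C := 1 + (covSeq X μ 0 + μ[X 0] ^ 2)) (fun p => hX.integral_abs_le p.1)
  refine key.2.trans ?_
  simp [hX.mean_eq]

omit [IsProbabilityMeasure μ] hX in
lemma measurable_sampled (n : ℕ) : Measurable (sampled X (randomWalk Δ) n) := by
  have h : Measurable (fun p : Ω × ℕ => X p.2 p.1) := measurable_from_prod_countable_left hXm
  exact h.comp (measurable_id.prodMk (measurable_randomWalk hΔ.measurable n))

lemma memLp_sampled (n : ℕ) : MemLp (sampled X (randomWalk Δ) n) 2 μ := by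
  rw [memLp_two_iff_integrable_sq (measurable_sampled hXm hΔ n).aestronglyMeasurable]
  have := (sampled_mul hXm hX hΔ n 0).1
  simpa [pow_two] using this

lemma cov_sampled (n h : ℕ) :
    cov[sampled X (randomWalk Δ) n, sampled X (randomWalk Δ) (n + h); μ] =
      ∫ ω, covSeq X μ (∑ j ∈ Finset.range h, Δ (n + j) ω) ∂μ := by
  rw [covariance_eq_sub (memLp_sampled hXm hX hΔ n) (memLp_sampled hXm hX hΔ (n + h)),
    sampled_mean hXm hX hΔ, sampled_mean hXm hX hΔ]
  simp only [Pi.mul_apply]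
  rw [(sampled_mul hXm hX hΔ n h).2]
  ring

omit hXm hX [IsProbabilityMeasure μ] in
lemma IsSampling.integral_exp (n : ℕ) (x : ℝ) :
    ∫ ω, Complex.exp (Complex.I * (Δ n ω : ℂ) * (x : ℂ)) ∂μ = charSeries S x := by
  have hb : ∀ j : ℕ, ‖Complex.exp (Complex.I * (j : ℂ) * (x : ℂ))‖ = 1 := fun j => by
    rw [show Complex.I * (j : ℂ) * (x : ℂ) = Complex.I * ((j * x : ℝ) : ℂ) by push_cast; ring,
      Complex.norm_exp_I_mul_ofReal]
  rw [← integral_map (φ := Δ n) (f := fun j : ℕ => Complex.exp (Complex.I * (j : ℂ) * (x : ℂ)))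
    (hΔ.measurable n).aemeasurable (measurable_of_countable _).aestronglyMeasurable,
    hΔ.law_eq, PMF.integral_eq_tsum]
  · rfl
  · exact Integrable.of_bound (measurable_of_countable _).aestronglyMeasurable 1
      (Eventually.of_forall fun j => (hb j).le)

omit hXm hX [IsProbabilityMeasure μ] in
lemma IsSampling.integral_exp_sum (n h : ℕ) (x : ℝ) :
    ∫ ω, Complex.exp (Complex.I * ((∑ j ∈ Finset.range h, Δ (n + j) ω : ℕ) : ℂ) * (x : ℂ)) ∂μ =
      charSeries S x ^ h := by
  have hi : iIndepFun (fun j : Fin h => Δ (n + j)) μ :=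
    hΔ.iIndep.precomp (g := fun j : Fin h => n + (j : ℕ)) (fun a b hab => by
      simpa [Fin.ext_iff] using hab)
  have := hi.integral_fun_prod_comp
    (f := fun _ (k : ℕ) => Complex.exp (Complex.I * (k : ℂ) * (x : ℂ)))
    (fun j => (hΔ.measurable _).aemeasurable)
    (fun j => (measurable_of_countable _).aestronglyMeasurable)
  simp only [hΔ.integral_exp, Finset.prod_const, Finset.card_univ, Fintype.card_fin] at this
  rw [← this]
  congr 1
  ext ω
  rw [← Complex.exp_sum, ← Fin.sum_univ_eq_sum_range (fun j => Δ (n + j) ω)]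
  push_cast
  rw [Finset.mul_sum, Finset.sum_mul]

end

section

variable {Ω : Type*} [MeasurableSpace Ω] {μ : Measure Ω} [IsProbabilityMeasure μ]
  {X : ℕ → Ω → ℝ} {Δ : ℕ → Ω → ℕ} {S : PMF ℕ} {f : ℝ → ℝ}

lemma integral_covSeq_sum (hX : HasSpectralDensity X μ f)
    (hΔ : IsSampling Δ S X μ) (n h : ℕ) :
    ((∫ ω, covSeq X μ (∑ j ∈ Finset.range h, Δ (n + j) ω) ∂μ : ℝ) : ℂ) =
      ∫ x in (-Real.pi)..Real.pi, (f x : ℂ) * charSeries S x ^ h := by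
  have hpi : -Real.pi ≤ Real.pi := by linarith [Real.pi_pos]
  have hm : Measurable (fun ω => ∑ j ∈ Finset.range h, Δ (n + j) ω) := by
    have := hΔ.measurable
    fun_prop
  set T : Ω → ℕ := fun ω => ∑ j ∈ Finset.range h, Δ (n + j) ω with hT
  rw [← integral_complex_ofReal]
  simp only [hX.covSeq_eq, intervalIntegral.integral_of_le hpi]
  have hf : Integrable f (volume.restrict (Set.Ioc (-Real.pi) Real.pi)) :=
    (intervalIntegrable_iff_integrableOn_Ioc_of_le hpi).1 hX.integrable
  rw [integral_integral_swap]
  · refine integral_congr_ae (Eventually.of_forall fun x => ?_)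
    simp only [integral_mul_const]
    rw [hΔ.integral_exp_sum n h x, mul_comm]
  · have h1 : Integrable (fun p : Ω × ℝ => (f p.2 : ℂ))
        (μ.prod (volume.restrict (Set.Ioc (-Real.pi) Real.pi))) :=
      (hf.ofReal (𝕜 := ℂ)).comp_snd μ
    refine h1.bdd_mul (c := 1) ?_ ?_
    · have : Measurable (fun p : Ω × ℝ => (T p.1 : ℂ)) :=
        (measurable_of_countable (fun k : ℕ => (k : ℂ))).comp (hm.comp measurable_fst)
      refine Measurable.aestronglyMeasurable ?_
      fun_prop
    · refine Eventually.of_forall fun p => ?_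
      rw [show Complex.I * ((T p.1 : ℕ) : ℂ) * (p.2 : ℂ)
        = Complex.I * ((T p.1 * p.2 : ℝ) : ℂ) by push_cast; ring,
        Complex.norm_exp_I_mul_ofReal]

theorem sampled_stationary (hXm : ∀ n, Measurable (X n)) (hX : HasSpectralDensity X μ f)
    (hΔ : IsSampling Δ S X μ) :
    IsSecondOrderStationary (sampled X (randomWalk Δ)) μ where
  memLp_two := memLp_sampled hXm hX.stationary hΔ
  mean_eq n := by
    rw [sampled_mean hXm hX.stationary hΔ, sampled_mean hXm hX.stationary hΔ]
  cov_eq n h := by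
    have h0 := cov_sampled hXm hX.stationary hΔ 0 h
    have h1 := integral_covSeq_sum hX hΔ n h
    rw [← integral_covSeq_sum hX hΔ 0 h] at h1
    rw [cov_sampled hXm hX.stationary hΔ n h, Complex.ofReal_injective h1, ← h0, Nat.zero_add]

theorem covSeq_sampled (hXm : ∀ n, Measurable (X n)) (hX : HasSpectralDensity X μ f)
    (hΔ : IsSampling Δ S X μ) (h : ℕ) :
    (covSeq (sampled X (randomWalk Δ)) μ h : ℂ) =
      ∫ x in (-Real.pi)..Real.pi, (f x : ℂ) * charSeries S x ^ h := by
  rw [← integral_covSeq_sum hX hΔ 0 h, ← cov_sampled hXm hX.stationary hΔ 0 h, Nat.zero_add]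
  rfl

end

end RandomSampling

namespace RandomSampling

section

variable (S : PMF ℕ)

lemma summable_toReal : Summable (fun j => (S j).toReal) :=
  ENNReal.summable_toReal S.tsum_coe_ne_top

lemma tsum_toReal : ∑' j, (S j).toReal = 1 := by
  rw [← ENNReal.tsum_toReal_eq S.apply_ne_top, S.tsum_coe, ENNReal.toReal_one]

lemma norm_exp_nat_mul (j : ℕ) (x : ℝ) :
    ‖Complex.exp (Complex.I * (j : ℂ) * (x : ℂ))‖ = 1 := by
  rw [show Complex.I * (j : ℂ) * (x : ℂ) = Complex.I * ((j * x : ℝ) : ℂ) by push_cast; ring,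
    Complex.norm_exp_I_mul_ofReal]

lemma norm_charSeries_term (j : ℕ) (x : ℝ) :
    ‖((S j).toReal : ℂ) * Complex.exp (Complex.I * (j : ℂ) * (x : ℂ))‖ = (S j).toReal := by
  rw [norm_mul, norm_exp_nat_mul, mul_one, Complex.norm_of_nonneg ENNReal.toReal_nonneg]

lemma summable_charSeries (x : ℝ) : Summable (fun j : ℕ =>
    ((S j).toReal : ℂ) * Complex.exp (Complex.I * (j : ℂ) * (x : ℂ))) :=
  Summable.of_norm (by simpa only [norm_charSeries_term] using summable_toReal S)

lemma norm_charSeries_le (x : ℝ) : ‖charSeries S x‖ ≤ 1 := by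
  rw [← tsum_toReal S]
  exact tsum_of_norm_bounded (summable_toReal S).hasSum fun j => (norm_charSeries_term S j x).le

lemma continuous_charSeries : Continuous (charSeries S) :=
  continuous_tsum (fun j => by fun_prop) (summable_toReal S)
    fun j x => (norm_charSeries_term S j x).le

lemma charSeries_neg (x : ℝ) : charSeries S (-x) = (starRingEnd ℂ) (charSeries S x) := by
  unfold charSeries
  rw [Complex.conj_tsum]
  refine tsum_congr fun j => ?_
  rw [map_mul, Complex.conj_ofReal, ← Complex.exp_conj]
  simp

lemma one_sub_charSeries (x : ℝ) : HasSum (fun j : ℕ =>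
    ((S j).toReal : ℂ) * (1 - Complex.exp (Complex.I * (j : ℂ) * (x : ℂ))))
    (1 - charSeries S x) := by
  have h1 : HasSum (fun j => ((S j).toReal : ℂ)) 1 := by
    have := (summable_toReal S).hasSum
    rw [tsum_toReal] at this
    have h2 := Complex.hasSum_ofReal.2 this
    rwa [Complex.ofReal_one] at h2
  have h2 : HasSum _ (charSeries S x) := (summable_charSeries S x).hasSum
  simpa only [mul_sub, mul_one] using h1.sub h2

lemma re_one_sub_charSeries (x : ℝ) : HasSum (fun j : ℕ =>
    (S j).toReal * (1 - Real.cos (j * x))) (1 - charSeries S x).re := by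
  refine (Complex.hasSum_re (one_sub_charSeries S x)).congr_fun ?_
  intro j
  rw [Complex.re_ofReal_mul, Complex.sub_re, Complex.one_re,
    show Complex.I * (j : ℂ) * (x : ℂ) = ((j * x : ℝ) : ℂ) * Complex.I by push_cast; ring,
    Complex.exp_ofReal_mul_I_re]

lemma exp_I_mul_ne_one {x : ℝ} (hx : x ∈ Set.Icc (-Real.pi) Real.pi) (h0 : x ≠ 0) :
    Complex.exp (Complex.I * (x : ℂ)) ≠ 1 := by
  intro h
  have h1 := congrArg Complex.re h
  rw [mul_comm, Complex.exp_ofReal_mul_I_re, Complex.one_re] at h1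
  exact h0 ((Real.cos_eq_one_iff_of_lt_of_lt (by linarith [hx.1, Real.pi_pos])
    (by linarith [hx.2, Real.pi_pos])).1 h1)

lemma norm_charSeries_lt_one {j : ℕ} (hj : 0 < (S j).toReal) (hj' : 0 < (S (j + 1)).toReal)
    {x : ℝ} (hx : x ∈ Set.Icc (-Real.pi) Real.pi) (h0 : x ≠ 0) : ‖charSeries S x‖ < 1 := by
  set a : ℕ → ℂ := fun k => ((S k).toReal : ℂ) * Complex.exp (Complex.I * (k : ℂ) * (x : ℂ))
    with ha
  set s : Finset ℕ := {j, j + 1} with hs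
  have hsplit := (summable_charSeries S x).sum_add_tsum_compl (s := s)
  have hsplit' := (summable_toReal S).sum_add_tsum_compl (s := s)
  have hrest : ‖∑' k : ↑((s : Set ℕ)ᶜ), a k‖ ≤ ∑' k : ↑((s : Set ℕ)ᶜ), (S k).toReal :=
    tsum_of_norm_bounded ((summable_toReal S).subtype _).hasSum
      fun k => (norm_charSeries_term S k x).le
  have hpair : ‖a j + a (j + 1)‖ < (S j).toReal + (S (j + 1)).toReal := by
    set E := Complex.exp (Complex.I * (x : ℂ)) with hE
    have hEn : ‖E‖ = 1 := Complex.norm_exp_I_mul_ofReal x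
    have h1 : a j + a (j + 1) = Complex.exp (Complex.I * (j : ℂ) * (x : ℂ)) *
        (((S j).toReal : ℂ) + ((S (j + 1)).toReal : ℂ) * E) := by
      simp only [ha, hE]
      rw [mul_add, mul_left_comm _ ((S (j + 1)).toReal : ℂ), ← Complex.exp_add]
      push_cast
      ring_nf
    rw [h1, norm_mul, norm_exp_nat_mul, one_mul]
    refine lt_of_le_of_ne ?_ fun heq => ?_
    · refine (norm_add_le _ _).trans_eq ?_
      rw [norm_mul, hEn, Complex.norm_of_nonneg hj.le, Complex.norm_of_nonneg hj'.le, mul_one]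
    · have h2 : E.re ^ 2 + E.im ^ 2 = 1 := by
        have := Complex.sq_norm E
        rw [hEn, Complex.normSq_apply] at this
        linarith
      have h3 := Complex.sq_norm (((S j).toReal : ℂ) + ((S (j + 1)).toReal : ℂ) * E)
      rw [heq, Complex.normSq_apply] at h3
      simp only [Complex.add_re, Complex.add_im, Complex.ofReal_re, Complex.ofReal_im,
        Complex.re_ofReal_mul, Complex.im_ofReal_mul] at h3
      set p := (S j).toReal
      set q := (S (j + 1)).toReal
      have h4 : p * q * (1 - E.re) = 0 := by linear_combination h3 / 2 + q ^ 2 / 2 * h2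
      have h5 : E.re = 1 := by
        have := (mul_eq_zero.1 h4).resolve_left (mul_pos hj hj').ne'
        linarith
      have h6 : E.im = 0 := by
        rw [h5] at h2
        nlinarith
      exact exp_I_mul_ne_one hx h0 (Complex.ext h5 h6)
  have hcs : charSeries S x = a j + a (j + 1) + ∑' k : ↑((s : Set ℕ)ᶜ), a k := by
    rw [charSeries, ← hsplit, hs, Finset.sum_pair (by simp)]
  rw [hs, Finset.sum_pair (by simp), tsum_toReal] at hsplit'
  rw [hcs]
  refine (norm_add_le _ _).trans_lt ?_
  linarith

lemma norm_one_sub_exp_le {β : ℝ} (hβ0 : 0 ≤ β) (hβ1 : β ≤ 1) (y : ℝ) :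
    ‖1 - Complex.exp (Complex.I * (y : ℂ))‖ ≤ 2 * |y| ^ β := by
  rw [norm_sub_rev]
  have h2 : ‖Complex.exp (Complex.I * (y : ℂ)) - 1‖ ≤ |y| :=
    Real.norm_exp_I_mul_ofReal_sub_one_le
  rcases le_total |y| 1 with h | h
  · rcases (abs_nonneg y).eq_or_lt with h0 | h0
    · rw [← h0] at h2
      exact h2.trans (by positivity)
    · have := Real.rpow_le_rpow_of_exponent_ge h0 h hβ1
      rw [Real.rpow_one] at this
      nlinarith
  · have h1 : ‖Complex.exp (Complex.I * (y : ℂ)) - 1‖ ≤ 2 := by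
      refine (norm_sub_le _ _).trans ?_
      rw [Complex.norm_exp_I_mul_ofReal, norm_one]
      norm_num
    have := Real.one_le_rpow h hβ0
    linarith

lemma norm_one_sub_charSeries_le {β : ℝ} (hβ0 : 0 ≤ β) (hβ1 : β ≤ 1)
    (hs : Summable (fun j : ℕ => (S j).toReal * (j : ℝ) ^ β)) (x : ℝ) :
    ‖1 - charSeries S x‖ ≤ 2 * (∑' j : ℕ, (S j).toReal * (j : ℝ) ^ β) * |x| ^ β := by
  rw [← (one_sub_charSeries S x).tsum_eq, mul_assoc, ← tsum_mul_right, ← tsum_mul_left]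
  refine tsum_of_norm_bounded ((hs.mul_right _).mul_left _).hasSum fun j => ?_
  have h := norm_one_sub_exp_le hβ0 hβ1 (j * x)
  rw [abs_mul, Nat.abs_cast, Real.mul_rpow (Nat.cast_nonneg j) (abs_nonneg x)] at h
  rw [norm_mul, Complex.norm_of_nonneg ENNReal.toReal_nonneg,
    show Complex.I * (j : ℂ) * (x : ℂ) = Complex.I * ((j * x : ℝ) : ℂ) by push_cast; ring]
  calc _ ≤ (S j).toReal * (2 * ((j : ℝ) ^ β * |x| ^ β)) :=
        mul_le_mul_of_nonneg_left h ENNReal.toReal_nonneg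
    _ = _ := by ring

variable {S} {c γ : ℝ}

lemma summable_moment (hS : Asymptotics.IsEquivalent atTop (fun j : ℕ => (S j).toReal)
      (fun j : ℕ => c * (j : ℝ) ^ (-γ))) {β : ℝ} (hβ : β < γ - 1) :
    Summable (fun j : ℕ => (S j).toReal * (j : ℝ) ^ β) := by
  have h1 : (fun j : ℕ => (S j).toReal * (j : ℝ) ^ β) =O[atTop]
      (fun j : ℕ => c * (j : ℝ) ^ (-γ) * (j : ℝ) ^ β) :=
    hS.isBigO.mul (Asymptotics.isBigO_refl _ _)
  have h2 : (fun j : ℕ => c * (j : ℝ) ^ (-γ) * (j : ℝ) ^ β) =ᶠ[atTop]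
      (fun j : ℕ => c * (j : ℝ) ^ (-γ + β)) := by
    filter_upwards [eventually_gt_atTop 0] with j hj
    rw [Real.rpow_add (Nat.cast_pos.2 hj), mul_assoc]
  exact summable_of_isBigO_nat ((Real.summable_nat_rpow.2 (by linarith)).mul_left c)
    (h1.trans_eventuallyEq h2)

lemma eventually_le_toReal (hc : 0 < c)
    (hS : Asymptotics.IsEquivalent atTop (fun j : ℕ => (S j).toReal)
      (fun j : ℕ => c * (j : ℝ) ^ (-γ))) :
    ∀ᶠ j : ℕ in atTop, c / 2 * (j : ℝ) ^ (-γ) ≤ (S j).toReal := by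
  filter_upwards [hS.isLittleO.def (half_pos one_pos)] with j hj
  have hp : 0 ≤ c * (j : ℝ) ^ (-γ) := by positivity
  rw [Real.norm_of_nonneg hp, Real.norm_eq_abs, abs_le] at hj
  simp only [Pi.sub_apply] at hj
  linarith [hj.1]

lemma exists_pos_pair (hc : 0 < c)
    (hS : Asymptotics.IsEquivalent atTop (fun j : ℕ => (S j).toReal)
      (fun j : ℕ => c * (j : ℝ) ^ (-γ))) :
    ∃ j, 0 < (S j).toReal ∧ 0 < (S (j + 1)).toReal := by
  obtain ⟨N, hN⟩ := eventually_atTop.1 (eventually_le_toReal hc hS)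
  have h : ∀ j, N + 1 ≤ j → 0 < (S j).toReal := fun j hj =>
    lt_of_lt_of_le (mul_pos (half_pos hc)
      (Real.rpow_pos_of_pos (Nat.cast_pos.2 (by omega)) _)) (hN j (by omega))
  exact ⟨N + 1, h _ le_rfl, h _ (by omega)⟩

lemma exists_le_re_one_sub_charSeries (hc : 0 < c) (hγ1 : 1 < γ)
    (hS : Asymptotics.IsEquivalent atTop (fun j : ℕ => (S j).toReal)
      (fun j : ℕ => c * (j : ℝ) ^ (-γ))) :
    ∃ k > 0, ∃ ε > 0, ∀ x : ℝ, x ≠ 0 → |x| < ε →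
      k * |x| ^ (γ - 1) ≤ (1 - charSeries S x).re := by
  obtain ⟨N₀, hN₀⟩ := eventually_atTop.1 (eventually_le_toReal hc hS)
  refine ⟨(2 : ℝ) ^ (-γ) * c / Real.pi ^ 2, by positivity, 1 / (N₀ + 1), by positivity,
    fun x hx0 hx => ?_⟩
  have hxp : 0 < |x| := abs_pos.2 hx0
  have hxinv : (N₀ : ℝ) + 1 ≤ 1 / |x| := by
    rw [le_div_iff₀ hxp]
    rw [lt_div_iff₀ (by positivity)] at hx
    linarith
  set N := ⌊1 / |x|⌋₊ with hN
  have hNN₀ : N₀ + 1 ≤ N := Nat.le_floor (by exact_mod_cast hxinv)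
  have hNle : (N : ℝ) ≤ 1 / |x| := Nat.floor_le (by positivity)
  have hNlt : 1 / |x| < N + 1 := Nat.lt_floor_add_one _
  have hNpos : (0 : ℝ) < N := Nat.cast_pos.2 (by omega)
  have hsum := re_one_sub_charSeries S x
  have hnn : ∀ j : ℕ, 0 ≤ (S j).toReal * (1 - Real.cos (j * x)) := fun j =>
    mul_nonneg ENNReal.toReal_nonneg (by linarith [Real.cos_le_one (j * x)])
  refine le_trans ?_ (sum_le_hasSum (Finset.Ioc N (2 * N)) (fun j _ => hnn j) hsum)
  have hterm : ∀ j ∈ Finset.Ioc N (2 * N),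
      c / 2 * (2 * N : ℝ) ^ (-γ) * (2 / Real.pi ^ 2) ≤ (S j).toReal * (1 - Real.cos (j * x)) := by
    intro j hj
    obtain ⟨hj1, hj2⟩ := Finset.mem_Ioc.1 hj
    have hj1' : (N : ℝ) + 1 ≤ j := by exact_mod_cast hj1
    have hj2' : (j : ℝ) ≤ 2 * N := by exact_mod_cast hj2
    have habs : |(j : ℝ) * x| = j * |x| := by rw [abs_mul, Nat.abs_cast]
    have hge : 1 ≤ |(j : ℝ) * x| := by
      rw [habs]
      rw [div_lt_iff₀ hxp] at hNlt
      nlinarith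
    have hle : |(j : ℝ) * x| ≤ Real.pi := by
      rw [habs]
      rw [le_div_iff₀ hxp] at hNle
      nlinarith [Real.pi_gt_three]
    have hcos := Real.cos_le_one_sub_mul_cos_sq hle
    have hsq : 1 ≤ ((j : ℝ) * x) ^ 2 := by
      rw [← sq_abs]
      nlinarith
    have hpi : 0 < 2 / Real.pi ^ 2 := by positivity
    refine mul_le_mul ?_ (by nlinarith) hpi.le ENNReal.toReal_nonneg
    refine le_trans (mul_le_mul_of_nonneg_left ?_ (half_pos hc).le) (hN₀ j (by omega))
    exact Real.rpow_le_rpow_of_nonpos (by linarith) hj2' (by linarith)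
  have h := Finset.card_nsmul_le_sum _ _ _ hterm
  rw [Nat.card_Ioc, show 2 * N - N = N by omega, nsmul_eq_mul] at h
  refine le_trans ?_ h
  have hpow : |x| ^ (γ - 1) ≤ (N : ℝ) * (N : ℝ) ^ (-γ) := by
    have h1 := Real.rpow_le_rpow_of_nonpos hNpos hNle (show 1 - γ ≤ 0 by linarith)
    rw [one_div, Real.inv_rpow hxp.le, ← Real.rpow_neg hxp.le, neg_sub] at h1
    rwa [sub_eq_add_neg 1 γ, Real.rpow_add hNpos, Real.rpow_one] at h1
  calc _ ≤ (2 : ℝ) ^ (-γ) * c / Real.pi ^ 2 * ((N : ℝ) * (N : ℝ) ^ (-γ)) :=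
        mul_le_mul_of_nonneg_left hpow (by positivity)
    _ = _ := by
        rw [Real.mul_rpow (by norm_num) hNpos.le]
        ring

/-- Near the origin `1 - |Ŝ(x)|` is at least of order `|x|^{γ-1}`. -/
lemma exists_le_one_sub_norm_charSeries (hc : 0 < c) (hγ1 : 1 < γ) (hγ2 : γ < 2)
    (hS : Asymptotics.IsEquivalent atTop (fun j : ℕ => (S j).toReal)
      (fun j : ℕ => c * (j : ℝ) ^ (-γ))) :
    ∃ k > 0, ∃ ε > 0, ∀ x : ℝ, x ≠ 0 → |x| < ε →
      k * |x| ^ (γ - 1) ≤ 1 - ‖charSeries S x‖ := by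
  obtain ⟨k, hk, ε, hε, h⟩ := exists_le_re_one_sub_charSeries hc hγ1 hS
  set β := 3 / 4 * (γ - 1) with hβ
  set K := 2 * (∑' j : ℕ, (S j).toReal * (j : ℝ) ^ β) with hK
  have hK0 : 0 ≤ K := mul_nonneg zero_le_two
    (tsum_nonneg fun j => mul_nonneg ENNReal.toReal_nonneg (by positivity))
  have hup := norm_one_sub_charSeries_le S (β := β) (by linarith) (by linarith)
    (summable_moment hS (by linarith))
  rw [← hK] at hup
  clear_value K
  have hlim : Tendsto (fun x : ℝ => K ^ 2 * |x| ^ (β * 2 - (γ - 1))) (𝓝 0) (𝓝 0) := by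
    have h1 : ContinuousAt (fun x : ℝ => K ^ 2 * |x| ^ (β * 2 - (γ - 1))) 0 :=
      continuousAt_const.mul (continuous_abs.continuousAt.rpow_const (Or.inr (by linarith)))
    have h2 := h1.tendsto
    simp only [abs_zero] at h2
    rwa [Real.zero_rpow (by linarith), mul_zero] at h2
  obtain ⟨ε', hε', h'⟩ := Metric.eventually_nhds_iff.1 (hlim.eventually_lt_const hk)
  refine ⟨k / 2, half_pos hk, min ε ε', lt_min hε hε', fun x hx0 hx => ?_⟩
  have hxp : 0 < |x| := abs_pos.2 hx0
  have h1 := h x hx0 (hx.trans_le (min_le_left _ _))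
  have h2 := @h' x (by simpa using hx.trans_le (min_le_right _ _))
  have h3 : ‖1 - charSeries S x‖ ^ 2 ≤ k * |x| ^ (γ - 1) := by
    calc ‖1 - charSeries S x‖ ^ 2 ≤ (K * |x| ^ β) ^ 2 :=
          pow_le_pow_left₀ (norm_nonneg _) (hup x) 2
      _ = K ^ 2 * |x| ^ (β * 2 - (γ - 1)) * |x| ^ (γ - 1) := by
          rw [mul_assoc, ← Real.rpow_add hxp, mul_pow, ← Real.rpow_mul_natCast hxp.le]
          congr 2
          push_cast
          ring
      _ ≤ k * |x| ^ (γ - 1) := by gcongr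
  have h4 := norm_charSeries_le S x
  have h5 : ‖charSeries S x‖ ^ 2 =
      1 - 2 * (1 - charSeries S x).re + ‖1 - charSeries S x‖ ^ 2 := by
    simp only [Complex.sq_norm, Complex.normSq_apply, Complex.sub_re, Complex.sub_im,
      Complex.one_re, Complex.one_im]
    ring
  nlinarith [norm_nonneg (charSeries S x)]

end

end RandomSampling

namespace RandomSampling

lemma intervalIntegrable_abs_rpow {p : ℝ} (hp : -1 < p) (a b : ℝ) :
    IntervalIntegrable (fun x : ℝ => |x| ^ p) volume a b := by
  have pos : ∀ a : ℝ, 0 ≤ a → IntervalIntegrable (fun x : ℝ => |x| ^ p) volume 0 a := by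
    intro a ha
    refine (intervalIntegral.intervalIntegrable_rpow' (a := 0) (b := a) hp).congr ?_
    intro x hx
    rw [Set.uIoc_of_le ha] at hx
    simp only [abs_of_pos hx.1]
  have all : ∀ a : ℝ, IntervalIntegrable (fun x : ℝ => |x| ^ p) volume 0 a := by
    intro a
    rcases le_total 0 a with ha | ha
    · exact pos a ha
    · have := (pos (-a) (by linarith)).comp_sub_left 0
      simpa using this
  exact (all a).symm.trans (all b)

lemma abs_le_norm_one_sub {r θ : ℝ} (hr : 0 ≤ r) (hθ : |θ| ≤ Real.pi) :
    |θ| / Real.pi ≤ ‖1 - (r : ℂ) * Complex.exp (-(Complex.I * (θ : ℂ)))‖ := by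
  have hpi := Real.pi_pos
  refine abs_le_of_sq_le_sq' ?_ (norm_nonneg _) |>.2
  have h1 : ‖1 - (r : ℂ) * Complex.exp (-(Complex.I * (θ : ℂ)))‖ ^ 2 =
      1 - 2 * r * Real.cos θ + r ^ 2 := by
    rw [Complex.sq_norm, Complex.normSq_apply,
      show -(Complex.I * (θ : ℂ)) = ((-θ : ℝ) : ℂ) * Complex.I by push_cast; ring]
    simp only [Complex.sub_re, Complex.sub_im, Complex.one_re, Complex.one_im,
      Complex.re_ofReal_mul, Complex.im_ofReal_mul, Complex.exp_ofReal_mul_I_re,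
      Complex.exp_ofReal_mul_I_im, Real.cos_neg, Real.sin_neg]
    linear_combination r ^ 2 * Real.sin_sq_add_cos_sq θ
  rw [h1, div_pow, sq_abs]
  have h2 := Real.cos_le_one_sub_mul_cos_sq hθ
  set q := θ ^ 2 / Real.pi ^ 2 with hq
  have hq0 : 0 ≤ q := by positivity
  have hq1 : q ≤ 1 := by
    rw [hq, div_le_one (by positivity), ← sq_abs]
    exact pow_le_pow_left₀ (abs_nonneg _) hθ 2
  rw [show 2 / Real.pi ^ 2 * θ ^ 2 = 2 * q by rw [hq]; ring] at h2
  nlinarith [mul_le_mul_of_nonneg_left h2 hr, mul_nonneg (sub_nonneg.2 hq1) (sq_nonneg (1 - r)),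
    mul_nonneg hq0 hr, mul_nonneg hq0 (mul_nonneg hr hr)]

/-- If `|1 - w|` is at most of order `y^{αt}` and `1 - |w|` at least of order `y^α`, then
`1 / |1 - r e^{-iθ} w|` is bounded by a product of powers of `y` and `|θ|`, uniformly in `r`. -/
lemma one_div_norm_one_sub_le {α t u k K : ℝ} (ht0 : 0 < t) (ht1 : t ≤ 1)
    (hu0 : 0 ≤ u) (hu1 : u ≤ 1) (hk : 0 < k) (hK : 0 ≤ K) {r θ y : ℝ} {w : ℂ}
    (hr0 : 0 ≤ r) (hr1 : r ≤ 1) (hθ : |θ| ≤ Real.pi) (hθ0 : θ ≠ 0) (hy : 0 < y)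
    (hlow : k * y ^ α ≤ 1 - ‖w‖) (hup : ‖1 - w‖ ≤ K * y ^ (α * t)) :
    1 / ‖1 - (r : ℂ) * Complex.exp (-(Complex.I * (θ : ℂ))) * w‖ ≤
      k ^ (-u) * (Real.pi * (2 + K / k ^ t)) ^ ((1 - u) / t) *
        (y ^ (-(α * u)) * |θ| ^ (-((1 - u) / t))) := by
  have hpi := Real.pi_pos
  have hθp : 0 < |θ| := abs_pos.2 hθ0
  set z : ℂ := (r : ℂ) * Complex.exp (-(Complex.I * (θ : ℂ))) with hz
  have hzn : ‖z‖ = r := by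
    rw [hz, norm_mul, Complex.norm_of_nonneg hr0,
      show -(Complex.I * (θ : ℂ)) = Complex.I * ((-θ : ℝ) : ℂ) by push_cast; ring,
      Complex.norm_exp_I_mul_ofReal, mul_one]
  set A := ‖1 - z * w‖ with hA
  set B := Real.pi * (2 + K / k ^ t) with hB
  have hyα : 0 < y ^ α := Real.rpow_pos_of_pos hy _
  have hBpos : 0 < B := by positivity
  have hA1 : k * y ^ α ≤ A := by
    have h1 : 1 - ‖z * w‖ ≤ A := by
      have := norm_sub_norm_le (1 : ℂ) (z * w)
      rwa [norm_one] at this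
    rw [norm_mul, hzn] at h1
    nlinarith [norm_nonneg w]
  have hApos : 0 < A := lt_of_lt_of_le (by positivity) hA1
  have hA2 : A ≤ 2 := by
    refine (norm_sub_le _ _).trans ?_
    rw [norm_one, norm_mul, hzn]
    have : 0 < k * y ^ α := by positivity
    nlinarith [norm_nonneg w]
  have hAt : A ≤ 2 * A ^ t := by
    have h1 := Real.rpow_le_rpow_of_exponent_ge (x := A / 2) (by positivity) (by linarith) ht1
    rw [Real.rpow_one, Real.div_rpow hApos.le zero_le_two] at h1
    have h2 : A ^ t / 2 ^ t ≤ A ^ t :=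
      div_le_self (by positivity) (Real.one_le_rpow one_le_two ht0.le)
    linarith
  have hyt : y ^ (α * t) ≤ A ^ t / k ^ t := by
    rw [← Real.div_rpow hApos.le hk.le, Real.rpow_mul hy.le]
    refine Real.rpow_le_rpow hyα.le ?_ ht0.le
    rw [le_div_iff₀ hk]
    linarith
  have hθA : |θ| ≤ B * A ^ t := by
    have h1 := abs_le_norm_one_sub hr0 hθ
    rw [← hz] at h1
    have h2 : ‖1 - z‖ ≤ A + ‖1 - w‖ := by
      calc ‖1 - z‖ = ‖(1 - z * w) - z * (1 - w)‖ := by congr 1; ring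
        _ ≤ A + ‖z * (1 - w)‖ := norm_sub_le _ _
        _ ≤ A + ‖1 - w‖ := by
          rw [norm_mul, hzn]
          nlinarith [norm_nonneg (1 - w)]
    have h3 : K * y ^ (α * t) ≤ K * (A ^ t / k ^ t) := mul_le_mul_of_nonneg_left hyt hK
    have h4 : |θ| / Real.pi ≤ (2 + K / k ^ t) * A ^ t := by
      calc _ ≤ 2 * A ^ t + K * (A ^ t / k ^ t) := by linarith
        _ = _ := by ring
    rw [div_le_iff₀ hpi] at h4
    calc |θ| ≤ _ := h4
      _ = B * A ^ t := by rw [hB]; ring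
  have hθB : (|θ| / B) ^ ((1 - u) / t) ≤ A ^ (1 - u) := by
    have h1 : |θ| / B ≤ A ^ t := by
      rw [div_le_iff₀ hBpos]
      linarith
    calc _ ≤ (A ^ t) ^ ((1 - u) / t) :=
          Real.rpow_le_rpow (by positivity) h1 (div_nonneg (by linarith) ht0.le)
      _ = A ^ (1 - u) := by
          rw [← Real.rpow_mul hApos.le]
          congr 1
          field_simp
  have hyu : (k * y ^ α) ^ u ≤ A ^ u := Real.rpow_le_rpow (by positivity) hA1 hu0
  have hprod : (k * y ^ α) ^ u * (|θ| / B) ^ ((1 - u) / t) ≤ A := by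
    calc _ ≤ A ^ u * A ^ (1 - u) := mul_le_mul hyu hθB (by positivity) (by positivity)
      _ = A := by rw [← Real.rpow_add hApos]; simp
  calc 1 / A ≤ 1 / ((k * y ^ α) ^ u * (|θ| / B) ^ ((1 - u) / t)) :=
        one_div_le_one_div_of_le (by positivity) hprod
    _ = _ := by
        rw [Real.mul_rpow hk.le hyα.le, Real.div_rpow hθp.le hBpos.le, ← Real.rpow_mul hy.le,
          Real.rpow_neg hk.le, Real.rpow_neg hy.le, Real.rpow_neg hθp.le]
        field_simp

end RandomSampling

noncomputable section

namespace RandomSampling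

/-- The integral `∫ f(x) / (1 - z w(x)) dx` over `[-π, π]`. -/
def resolventIntegral (f : ℝ → ℝ) (w : ℝ → ℂ) (z : ℂ) : ℂ :=
  ∫ x in (-Real.pi)..Real.pi, (f x : ℂ) * (1 / (1 - z * w x))

/-- The point `r e^{-iθ}`. -/
def polarPoint (r θ : ℝ) : ℂ := (r : ℂ) * Complex.exp (-(Complex.I * (θ : ℂ)))

lemma neg_pi_le_pi : -Real.pi ≤ Real.pi := by linarith [Real.pi_pos]

lemma continuous_polarPoint : Continuous fun p : ℝ × ℝ => polarPoint p.1 p.2 := by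
  unfold polarPoint
  fun_prop

lemma norm_polarPoint {r : ℝ} (hr : 0 ≤ r) (θ : ℝ) : ‖polarPoint r θ‖ = r := by
  rw [polarPoint, norm_mul, Complex.norm_of_nonneg hr,
    show -(Complex.I * (θ : ℂ)) = Complex.I * ((-θ : ℝ) : ℂ) by push_cast; ring,
    Complex.norm_exp_I_mul_ofReal, mul_one]

lemma conj_polarPoint (r θ : ℝ) : (starRingEnd ℂ) (polarPoint r θ) =
    (r : ℂ) * Complex.exp (Complex.I * (θ : ℂ)) := by
  rw [polarPoint, map_mul, Complex.conj_ofReal, ← Complex.exp_conj]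
  simp

lemma tendsto_polarPoint (θ : ℝ) :
    Tendsto (fun r => polarPoint r θ) (𝓝[<] 1) (𝓝 (polarPoint 1 θ)) := by
  have h : Continuous fun r => polarPoint r θ :=
    continuous_polarPoint.comp (continuous_id.prodMk continuous_const)
  exact h.continuousAt.tendsto.mono_left nhdsWithin_le_nhds

lemma eventually_mem_Ico_zero_one : ∀ᶠ r : ℝ in 𝓝[<] 1, r ∈ Set.Ico (0 : ℝ) 1 :=
  Ico_mem_nhdsLT zero_lt_one

section

variable {f : ℝ → ℝ} {w : ℝ → ℂ}

lemma one_sub_mul_ne_zero {z a : ℂ} (hz : ‖z‖ < 1) (ha : ‖a‖ ≤ 1) : 1 - z * a ≠ 0 := by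
  intro h
  have h1 : ‖z * a‖ = 1 := by rw [← sub_eq_zero.1 h, norm_one]
  rw [norm_mul] at h1
  nlinarith [norm_nonneg z, norm_nonneg a]

lemma aestronglyMeasurable_ofReal (hf : IntervalIntegrable f volume (-Real.pi) Real.pi) :
    AEStronglyMeasurable (fun x => (f x : ℂ))
      (volume.restrict (Set.uIoc (-Real.pi) Real.pi)) :=
  Complex.continuous_ofReal.comp_aestronglyMeasurable hf.def'.aestronglyMeasurable

lemma intervalIntegrable_ofReal (hf : IntervalIntegrable f volume (-Real.pi) Real.pi) :
    IntervalIntegrable (fun x => (f x : ℂ)) volume (-Real.pi) Real.pi := by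
  rw [intervalIntegrable_iff] at hf ⊢
  exact hf.ofReal

lemma intervalIntegrable_resolvent (hf : IntervalIntegrable f volume (-Real.pi) Real.pi)
    (hw : Continuous w) {z : ℂ} (hz : ∀ x ∈ Set.Icc (-Real.pi) Real.pi, 1 - z * w x ≠ 0) :
    IntervalIntegrable (fun x => (f x : ℂ) * (1 / (1 - z * w x))) volume (-Real.pi) Real.pi := by
  refine (intervalIntegrable_ofReal hf).mul_continuousOn ?_
  rw [Set.uIcc_of_le neg_pi_le_pi]
  exact ContinuousOn.div continuousOn_const (by fun_prop) hz

lemma continuousAt_resolventIntegral (hf : IntervalIntegrable f volume (-Real.pi) Real.pi)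
    (hw : Continuous w) (hw1 : ∀ x, ‖w x‖ ≤ 1) {z : ℂ}
    (hz : ∀ x ∈ Set.Icc (-Real.pi) Real.pi, 1 - z * w x ≠ 0) :
    ContinuousAt (resolventIntegral f w) z := by
  obtain ⟨x₀, hx₀, hmin⟩ := isCompact_Icc.exists_isMinOn
    (Set.nonempty_Icc.2 neg_pi_le_pi)
    (f := fun x => ‖1 - z * w x‖) (by fun_prop)
  set δ := ‖1 - z * w x₀‖ with hδ
  have hδ0 : 0 < δ := norm_pos_iff.2 (hz x₀ hx₀)
  have hlow : ∀ z' ∈ Metric.ball z (δ / 2), ∀ x ∈ Set.Icc (-Real.pi) Real.pi,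
      δ / 2 ≤ ‖1 - z' * w x‖ := by
    intro z' hz' x hx
    have h1 : δ ≤ ‖1 - z * w x‖ := hmin hx
    have h2 : ‖1 - z * w x‖ ≤ ‖1 - z' * w x‖ + ‖z' - z‖ := by
      calc ‖1 - z * w x‖ = ‖(1 - z' * w x) + (z' - z) * w x‖ := by congr 1; ring
        _ ≤ ‖1 - z' * w x‖ + ‖(z' - z) * w x‖ := norm_add_le _ _
        _ ≤ _ := by
          rw [norm_mul]
          nlinarith [norm_nonneg (z' - z), hw1 x]
    rw [Metric.mem_ball, dist_eq_norm] at hz'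
    linarith
  have hball : ∀ᶠ z' in 𝓝 z, z' ∈ Metric.ball z (δ / 2) := Metric.ball_mem_nhds z (half_pos hδ0)
  have hIcc : ∀ x ∈ Set.uIoc (-Real.pi) Real.pi, x ∈ Set.Icc (-Real.pi) Real.pi := by
    intro x hx
    rw [Set.uIoc_of_le neg_pi_le_pi] at hx
    exact Set.Ioc_subset_Icc_self hx
  refine intervalIntegral.continuousAt_of_dominated_interval
    (bound := fun x => ‖f x‖ * (1 / (δ / 2))) ?_ ?_ (hf.norm.mul_const _) ?_
  · filter_upwards [hball] with z' hz'
    refine (intervalIntegrable_resolvent hf hw fun x hx h0 => ?_).def'.aestronglyMeasurable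
    have := hlow z' hz' x hx
    rw [h0, norm_zero] at this
    linarith
  · filter_upwards [hball] with z' hz'
    refine Eventually.of_forall fun x hx => ?_
    rw [norm_mul, norm_div, norm_one, Complex.norm_real]
    exact mul_le_mul_of_nonneg_left
      (one_div_le_one_div_of_le (half_pos hδ0) (hlow z' hz' x (hIcc x hx))) (norm_nonneg _)
  · refine Eventually.of_forall fun x hx => ?_
    exact continuousAt_const.mul (continuousAt_const.div (by fun_prop) (hz x (hIcc x hx)))

lemma hasSum_resolventIntegral (hf : IntervalIntegrable f volume (-Real.pi) Real.pi)
    (hw : Continuous w) (hw1 : ∀ x, ‖w x‖ ≤ 1) {z : ℂ} (hz : ‖z‖ < 1) :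
    HasSum (fun j : ℕ => (∫ x in (-Real.pi)..Real.pi, (f x : ℂ) * w x ^ j) * z ^ j)
      (resolventIntegral f w z) := by
  have key := intervalIntegral.hasSum_integral_of_dominated_convergence
    (μ := volume) (a := -Real.pi) (b := Real.pi)
    (F := fun (j : ℕ) x => (f x : ℂ) * w x ^ j * z ^ j)
    (f := fun x => (f x : ℂ) * (1 / (1 - z * w x)))
    (bound := fun j x => ‖f x‖ * ‖z‖ ^ j) ?_ ?_ ?_ ?_ ?_
  · simp only [intervalIntegral.integral_mul_const] at key
    exact key
  · intro j
    exact ((aestronglyMeasurable_ofReal hf).mul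
      (hw.pow j).aestronglyMeasurable).mul aestronglyMeasurable_const
  · intro j
    refine Eventually.of_forall fun x _ => ?_
    rw [norm_mul, norm_mul, norm_pow, norm_pow, Complex.norm_real]
    refine mul_le_mul_of_nonneg_right ?_ (by positivity)
    exact mul_le_of_le_one_right (norm_nonneg _) (pow_le_one₀ (norm_nonneg _) (hw1 x))
  · exact Eventually.of_forall fun x _ =>
      (summable_geometric_of_lt_one (norm_nonneg _) hz).mul_left _
  · simp only [tsum_mul_left]
    exact hf.norm.mul_const _
  · refine Eventually.of_forall fun x _ => ?_
    have h1 : ‖z * w x‖ < 1 := by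
      rw [norm_mul]
      nlinarith [norm_nonneg z, norm_nonneg (w x), hw1 x]
    have h2 := (hasSum_geometric_of_norm_lt_one h1).mul_left (f x : ℂ)
    rw [one_div]
    refine h2.congr_fun ?_
    intro j
    rw [mul_pow]
    ring

lemma integral_exp_int_mul (n : ℤ) :
    ∫ θ in (-Real.pi)..Real.pi, Complex.exp (Complex.I * (n : ℂ) * (θ : ℂ)) =
      if n = 0 then 2 * (Real.pi : ℂ) else 0 := by
  split_ifs with h
  · simp [h]
    ring
  · have hc : Complex.I * (n : ℂ) ≠ 0 := mul_ne_zero Complex.I_ne_zero (Int.cast_ne_zero.2 h)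
    rw [integral_exp_mul_complex hc, div_eq_zero_iff]
    left
    rw [sub_eq_zero, Complex.exp_eq_exp_iff_exists_int]
    exact ⟨n, by push_cast; ring⟩

/-- Fourier coefficients of `∑ a_j r^j e^{-ijθ}`. -/
lemma integral_exp_mul_of_hasSum {a : ℕ → ℂ} {C : ℝ} (ha : ∀ j, ‖a j‖ ≤ C) {r : ℝ} (hr0 : 0 ≤ r)
    (hr1 : r < 1) {H : ℝ → ℂ} (hH : ∀ θ, HasSum (fun j => a j * polarPoint r θ ^ j) (H θ)) (n : ℤ) :
    ∫ θ in (-Real.pi)..Real.pi, Complex.exp (Complex.I * (n : ℂ) * (θ : ℂ)) * H θ =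
      if 0 ≤ n then 2 * (Real.pi : ℂ) * (a n.toNat * (r : ℂ) ^ n.toNat) else 0 := by
  have hE : ∀ (m : ℤ) (θ : ℝ), ‖Complex.exp (Complex.I * (m : ℂ) * (θ : ℂ))‖ = 1 := fun m θ => by
    rw [show Complex.I * (m : ℂ) * (θ : ℂ) = Complex.I * ((m * θ : ℝ) : ℂ) by push_cast; ring,
      Complex.norm_exp_I_mul_ofReal]
  have hterm : ∀ (j : ℕ) (θ : ℝ), Complex.exp (Complex.I * (n : ℂ) * (θ : ℂ)) *
      (a j * polarPoint r θ ^ j) =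
      a j * (r : ℂ) ^ j * Complex.exp (Complex.I * ((n - j : ℤ) : ℂ) * (θ : ℂ)) := by
    intro j θ
    rw [polarPoint, mul_pow, ← Complex.exp_nat_mul,
      show Complex.I * ((n - j : ℤ) : ℂ) * (θ : ℂ) =
        Complex.I * (n : ℂ) * (θ : ℂ) + (j : ℂ) * -(Complex.I * (θ : ℂ)) by push_cast; ring,
      Complex.exp_add]
    ring
  have key := intervalIntegral.hasSum_integral_of_dominated_convergence
    (μ := volume) (a := -Real.pi) (b := Real.pi)
    (F := fun (j : ℕ) θ => a j * (r : ℂ) ^ j *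
      Complex.exp (Complex.I * ((n - j : ℤ) : ℂ) * (θ : ℂ)))
    (f := fun θ => Complex.exp (Complex.I * (n : ℂ) * (θ : ℂ)) * H θ)
    (bound := fun j _ => C * r ^ j) ?_ ?_ ?_ ?_ ?_
  · simp only [intervalIntegral.integral_const_mul, integral_exp_int_mul] at key
    refine HasSum.unique key ?_
    split_ifs with hn
    · have := hasSum_single (f := fun j : ℕ => a j * (r : ℂ) ^ j *
        (if n - (j : ℤ) = 0 then 2 * (Real.pi : ℂ) else 0)) n.toNat (fun j hj => by
          rw [if_neg (by omega), mul_zero])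
      rw [if_pos (by omega), mul_comm _ (2 * (Real.pi : ℂ))] at this
      exact this
    · refine HasSum.congr_fun hasSum_zero fun j => ?_
      rw [if_neg (by omega), mul_zero]
  · intro j
    exact Continuous.aestronglyMeasurable (by fun_prop)
  · intro j
    refine Eventually.of_forall fun x _ => ?_
    rw [norm_mul, hE, mul_one, norm_mul, norm_pow, Complex.norm_of_nonneg hr0]
    exact mul_le_mul_of_nonneg_right (ha j) (by positivity)
  · exact Eventually.of_forall fun x _ => (summable_geometric_of_lt_one hr0 hr1).mul_left _
  · exact intervalIntegrable_const
  · refine Eventually.of_forall fun θ _ => ?_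
    simpa only [hterm] using (hH θ).mul_left (Complex.exp (Complex.I * (n : ℂ) * (θ : ℂ)))

variable (hf : IntervalIntegrable f volume (-Real.pi) Real.pi)
  (hw : Continuous w) (hw1 : ∀ x, ‖w x‖ ≤ 1)
  (hne : ∀ θ ∈ Set.Icc (-Real.pi) Real.pi, θ ≠ 0 →
    ∀ x ∈ Set.Icc (-Real.pi) Real.pi, 1 - polarPoint 1 θ * w x ≠ 0)

include hf hw hw1 hne

lemma tendsto_resolventIntegral {θ : ℝ} (hθ : θ ∈ Set.Icc (-Real.pi) Real.pi) (h0 : θ ≠ 0) :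
    Tendsto (fun r => resolventIntegral f w (polarPoint r θ)) (𝓝[<] 1)
      (𝓝 (resolventIntegral f w (polarPoint 1 θ))) :=
  (continuousAt_resolventIntegral hf hw hw1 (hne θ hθ h0)).tendsto.comp (tendsto_polarPoint θ)

variable {D : ℝ → ℝ} (hD : IntervalIntegrable D volume (-Real.pi) Real.pi)
  (hbound : ∀ r ∈ Set.Ico (0 : ℝ) 1, ∀ θ ∈ Set.Icc (-Real.pi) Real.pi, θ ≠ 0 →
    ‖resolventIntegral f w (polarPoint r θ)‖ ≤ D θ)

omit hne in
lemma aestronglyMeasurable_resolventIntegral {r : ℝ} (hr : r ∈ Set.Ico (0 : ℝ) 1) (s : Set ℝ) :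
    AEStronglyMeasurable (fun θ => resolventIntegral f w (polarPoint r θ))
      (volume.restrict s) := by
  refine Continuous.aestronglyMeasurable (continuous_iff_continuousAt.2 fun θ => ?_)
  have h1 : ContinuousAt (fun θ => polarPoint r θ) θ :=
    (continuous_polarPoint.comp (continuous_const.prodMk continuous_id)).continuousAt
  refine ContinuousAt.comp (g := resolventIntegral f w) (f := fun θ => polarPoint r θ) ?_ h1
  exact continuousAt_resolventIntegral hf hw hw1 fun x _ =>
    one_sub_mul_ne_zero (by rw [norm_polarPoint hr.1]; exact hr.2) (hw1 x)

omit hf hw hw1 hne in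
lemma ae_mem_Icc_ne_zero : ∀ᵐ θ : ℝ, θ ∈ Set.uIoc (-Real.pi) Real.pi →
    θ ∈ Set.Icc (-Real.pi) Real.pi ∧ θ ≠ 0 := by
  have h0 : ∀ᵐ θ : ℝ, θ ≠ 0 := by simp [ae_iff]
  filter_upwards [h0] with θ hθ hm
  rw [Set.uIoc_of_le neg_pi_le_pi] at hm
  exact ⟨Set.Ioc_subset_Icc_self hm, hθ⟩

include hD hbound

lemma intervalIntegrable_resolventIntegral :
    IntervalIntegrable (fun θ => resolventIntegral f w (polarPoint 1 θ)) volume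
      (-Real.pi) Real.pi := by
  have hae : ∀ᵐ θ ∂(volume.restrict (Set.uIoc (-Real.pi) Real.pi)),
      Tendsto (fun r => resolventIntegral f w (polarPoint r θ)) (𝓝[<] 1)
        (𝓝 (resolventIntegral f w (polarPoint 1 θ))) := by
    rw [ae_restrict_iff' measurableSet_uIoc]
    filter_upwards [ae_mem_Icc_ne_zero] with θ hθ hm
    exact tendsto_resolventIntegral hf hw hw1 hne (hθ hm).1 (hθ hm).2
  refine hD.mono_fun ?_ ?_
  · obtain ⟨s, hs1⟩ := exists_seq_tendsto (𝓝[<] (1 : ℝ))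
    have hs3 : ∀ᶠ n in atTop, s n ∈ Set.Ico (0 : ℝ) 1 := hs1.eventually eventually_mem_Ico_zero_one
    obtain ⟨N, hN⟩ := eventually_atTop.1 hs3
    refine aestronglyMeasurable_of_tendsto_ae atTop
      (f := fun n θ => resolventIntegral f w (polarPoint (s (n + N)) θ))
      (fun n => aestronglyMeasurable_resolventIntegral hf hw hw1 (hN _ (by omega)) _) ?_
    filter_upwards [hae] with θ hθ
    exact hθ.comp (hs1.comp (tendsto_add_atTop_nat N))
  · rw [EventuallyLE, ae_restrict_iff' measurableSet_uIoc]
    filter_upwards [ae_mem_Icc_ne_zero] with θ hθ hm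
    obtain ⟨h1, h2⟩ := hθ hm
    refine le_trans ?_ (le_abs_self (D θ))
    refine le_of_tendsto (tendsto_resolventIntegral hf hw hw1 hne h1 h2).norm ?_
    filter_upwards [eventually_mem_Ico_zero_one] with r hr
    exact hbound r hr θ h1 h2

lemma integral_exp_mul_resolventIntegral (n : ℤ) :
    ∫ θ in (-Real.pi)..Real.pi, Complex.exp (Complex.I * (n : ℂ) * (θ : ℂ)) *
        resolventIntegral f w (polarPoint 1 θ) =
      if 0 ≤ n then 2 * (Real.pi : ℂ) *
        ∫ x in (-Real.pi)..Real.pi, (f x : ℂ) * w x ^ n.toNat else 0 := by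
  have hE : ∀ θ : ℝ, ‖Complex.exp (Complex.I * (n : ℂ) * (θ : ℂ))‖ = 1 := fun θ => by
    rw [show Complex.I * (n : ℂ) * (θ : ℂ) = Complex.I * ((n * θ : ℝ) : ℂ) by push_cast; ring,
      Complex.norm_exp_I_mul_ofReal]
  have hlim : Tendsto (fun r => ∫ θ in (-Real.pi)..Real.pi,
      Complex.exp (Complex.I * (n : ℂ) * (θ : ℂ)) * resolventIntegral f w (polarPoint r θ))
      (𝓝[<] 1) (𝓝 (∫ θ in (-Real.pi)..Real.pi, Complex.exp (Complex.I * (n : ℂ) * (θ : ℂ)) *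
        resolventIntegral f w (polarPoint 1 θ))) := by
    refine intervalIntegral.tendsto_integral_filter_of_dominated_convergence D ?_ ?_ hD ?_
    · filter_upwards [eventually_mem_Ico_zero_one] with r hr
      exact (Continuous.aestronglyMeasurable (by fun_prop)).mul
        (aestronglyMeasurable_resolventIntegral hf hw hw1 hr _)
    · filter_upwards [eventually_mem_Ico_zero_one] with r hr
      filter_upwards [ae_mem_Icc_ne_zero] with θ hθ hm
      rw [norm_mul, hE, one_mul]
      exact hbound r hr θ (hθ hm).1 (hθ hm).2
    · filter_upwards [ae_mem_Icc_ne_zero] with θ hθ hm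
      exact (tendsto_resolventIntegral hf hw hw1 hne (hθ hm).1 (hθ hm).2).const_mul _
  have hmom : ∀ j : ℕ, ‖∫ x in (-Real.pi)..Real.pi, (f x : ℂ) * w x ^ j‖ ≤
      ∫ x in (-Real.pi)..Real.pi, ‖f x‖ := by
    intro j
    refine intervalIntegral.norm_integral_le_of_norm_le neg_pi_le_pi
      (Eventually.of_forall fun x _ => ?_) hf.norm
    rw [norm_mul, norm_pow, Complex.norm_real]
    exact mul_le_of_le_one_right (norm_nonneg _) (pow_le_one₀ (norm_nonneg _) (hw1 x))
  refine tendsto_nhds_unique hlim ?_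
  have hev : ∀ᶠ r : ℝ in 𝓝[<] 1, (if 0 ≤ n then 2 * (Real.pi : ℂ) *
      ((∫ x in (-Real.pi)..Real.pi, (f x : ℂ) * w x ^ n.toNat) * (r : ℂ) ^ n.toNat) else 0) =
      ∫ θ in (-Real.pi)..Real.pi, Complex.exp (Complex.I * (n : ℂ) * (θ : ℂ)) *
        resolventIntegral f w (polarPoint r θ) := by
    filter_upwards [eventually_mem_Ico_zero_one] with r hr
    refine (integral_exp_mul_of_hasSum hmom hr.1 hr.2 (fun θ => ?_) n).symm
    exact hasSum_resolventIntegral hf hw hw1 (by rw [norm_polarPoint hr.1]; exact hr.2)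
  refine Tendsto.congr' hev ?_
  split_ifs
  · have h1 : Continuous fun r : ℝ => 2 * (Real.pi : ℂ) *
        ((∫ x in (-Real.pi)..Real.pi, (f x : ℂ) * w x ^ n.toNat) * (r : ℂ) ^ n.toNat) := by
      fun_prop
    have h2 := (h1.tendsto 1).mono_left (nhdsWithin_le_nhds (s := Set.Iio 1))
    simpa using h2
  · exact tendsto_const_nhds

omit hbound hD hw1 in
/-- Positivity of the Poisson type kernel `2 Re (1 / (1 - ζ)) - 1` for `|ζ| ≤ 1`, integrated. -/
lemma integral_le_two_mul_re_resolventIntegral (hw1 : ∀ x, ‖w x‖ ≤ 1)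
    (hf0 : ∀ x ∈ Set.Icc (-Real.pi) Real.pi, 0 ≤ f x)
    {θ : ℝ} (hθ : θ ∈ Set.Icc (-Real.pi) Real.pi) (h0 : θ ≠ 0) :
    ∫ x in (-Real.pi)..Real.pi, f x ≤ 2 * (resolventIntegral f w (polarPoint 1 θ)).re := by
  have hint := intervalIntegrable_resolvent hf hw (hne θ hθ h0)
  have hre : (resolventIntegral f w (polarPoint 1 θ)).re =
      ∫ x in (-Real.pi)..Real.pi, f x * (1 / (1 - polarPoint 1 θ * w x)).re := by
    rw [resolventIntegral, ← Complex.reCLM_apply,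
      ← ContinuousLinearMap.intervalIntegral_comp_comm _ hint]
    refine intervalIntegral.integral_congr fun x _ => ?_
    simp only [Complex.reCLM_apply, Complex.re_ofReal_mul]
  rw [hre, ← intervalIntegral.integral_const_mul]
  have hint' : IntervalIntegrable
      (fun x => f x * (1 / (1 - polarPoint 1 θ * w x)).re) volume (-Real.pi) Real.pi := by
    refine hf.mul_continuousOn ?_
    rw [Set.uIcc_of_le neg_pi_le_pi]
    exact Complex.continuous_re.comp_continuousOn
      (ContinuousOn.div continuousOn_const (by fun_prop) (hne θ hθ h0))
  refine intervalIntegral.integral_mono_on neg_pi_le_pi hf (hint'.const_mul 2) fun x hx => ?_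
  have hker : 1 ≤ 2 * (1 / (1 - polarPoint 1 θ * w x)).re := by
    have hζ0 := hne θ hθ h0 x hx
    have hζ : ‖polarPoint 1 θ * w x‖ ≤ 1 := by
      rw [norm_mul, norm_polarPoint zero_le_one, one_mul]
      exact hw1 x
    set ζ := polarPoint 1 θ * w x
    have h1 : 0 < Complex.normSq (1 - ζ) := Complex.normSq_pos.2 hζ0
    have h2 : ‖ζ‖ ^ 2 ≤ 1 := pow_le_one₀ (norm_nonneg _) hζ
    rw [one_div, Complex.inv_re, ← mul_div_assoc, le_div_iff₀ h1, one_mul]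
    rw [Complex.sq_norm, Complex.normSq_apply] at h2
    rw [Complex.normSq_apply]
    simp only [Complex.sub_re, Complex.sub_im, Complex.one_re, Complex.one_im]
    nlinarith
  nlinarith [mul_le_mul_of_nonneg_left hker (hf0 x hx)]

end

end RandomSampling

end

namespace RandomSampling

section

variable {S : PMF ℕ} {c γ : ℝ}

lemma charSeries_zero (S : PMF ℕ) : charSeries S 0 = 1 := by
  have h := one_sub_charSeries S 0
  simp only [Complex.ofReal_zero, mul_zero, Complex.exp_zero, sub_self] at h
  exact (sub_eq_zero.1 (h.unique hasSum_zero)).symm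

lemma one_sub_polarPoint_mul_charSeries_ne_zero {j : ℕ} (hj : 0 < (S j).toReal)
    (hj' : 0 < (S (j + 1)).toReal) {θ : ℝ} (hθ : θ ∈ Set.Icc (-Real.pi) Real.pi) (h0 : θ ≠ 0)
    {x : ℝ} (hx : x ∈ Set.Icc (-Real.pi) Real.pi) :
    1 - polarPoint 1 θ * charSeries S x ≠ 0 := by
  rcases eq_or_ne x 0 with rfl | hx0
  · rw [charSeries_zero, mul_one, sub_ne_zero]
    have h := exp_I_mul_ne_one (x := -θ) ⟨by linarith [hθ.2], by linarith [hθ.1]⟩ (neg_ne_zero.2 h0)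
    rw [polarPoint, Complex.ofReal_one, one_mul]
    push_cast at h
    rw [mul_neg] at h
    exact h.symm
  · rw [mul_comm]
    exact one_sub_mul_ne_zero (norm_charSeries_lt_one S hj hj' hx hx0)
      (norm_polarPoint zero_le_one θ).le

lemma exists_pos_le_one_sub_norm_charSeries {j : ℕ} (hj : 0 < (S j).toReal)
    (hj' : 0 < (S (j + 1)).toReal) {ε : ℝ} (hε : 0 < ε) (hεπ : ε ≤ Real.pi) :
    ∃ q > 0, ∀ x ∈ Set.Icc (-Real.pi) Real.pi, ε ≤ |x| → q ≤ 1 - ‖charSeries S x‖ := by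
  have hcomp : IsCompact (Set.Icc (-Real.pi) Real.pi ∩ {x | ε ≤ |x|}) :=
    isCompact_Icc.inter_right (isClosed_le continuous_const continuous_abs)
  have hne : (Set.Icc (-Real.pi) Real.pi ∩ {x | ε ≤ |x|}).Nonempty :=
    ⟨Real.pi, ⟨neg_pi_le_pi, le_rfl⟩, by simpa [abs_of_pos Real.pi_pos] using hεπ⟩
  have hcont := continuous_charSeries S
  obtain ⟨x₀, hx₀, hmin⟩ := hcomp.exists_isMinOn hne (f := fun x => 1 - ‖charSeries S x‖)
    (by fun_prop)
  refine ⟨1 - ‖charSeries S x₀‖, ?_, fun x hx hεx => hmin ⟨hx, hεx⟩⟩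
  have hx₀0 : x₀ ≠ 0 := fun h => by
    have h1 : ε ≤ |x₀| := hx₀.2
    rw [h, abs_zero] at h1
    linarith
  exact sub_pos.2 (norm_charSeries_lt_one S hj hj' hx₀.1 hx₀0)

/-- The resolvent integrals on the circles of radius `r < 1` have an integrable majorant. -/
lemma exists_integrable_bound_resolventIntegral {f φ : ℝ → ℝ} {d : ℝ} (hd0 : 0 ≤ d)
    (hd : d < 1 / 2) (hf : IntervalIntegrable f volume (-Real.pi) Real.pi)
    (hf0 : ∀ x ∈ Set.Icc (-Real.pi) Real.pi, 0 ≤ f x)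
    (hfφ : ∀ x ∈ Set.Icc (-Real.pi) Real.pi, x ≠ 0 → f x = |x| ^ (-2 * d) * φ x)
    (hφb : ∃ ε > 0, ∃ M : ℝ, ∀ x : ℝ, |x| < ε → φ x ≤ M)
    (hc : 0 < c) (hγ1 : 1 < γ) (hγ2 : γ < 2)
    (hS : Asymptotics.IsEquivalent atTop (fun j : ℕ => (S j).toReal)
      (fun j : ℕ => c * (j : ℝ) ^ (-γ))) :
    ∃ D : ℝ → ℝ, IntervalIntegrable D volume (-Real.pi) Real.pi ∧
      ∀ r ∈ Set.Ico (0 : ℝ) 1, ∀ θ ∈ Set.Icc (-Real.pi) Real.pi, θ ≠ 0 →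
        ‖resolventIntegral f (charSeries S) (polarPoint r θ)‖ ≤ D θ := by
  obtain ⟨j, hj, hj'⟩ := exists_pos_pair hc hS
  obtain ⟨k, hk, ε₁, hε₁, hlow⟩ := exists_le_one_sub_norm_charSeries hc hγ1 hγ2 hS
  obtain ⟨ε₂, hε₂, M, hM⟩ := hφb
  set ε := min (min ε₁ ε₂) Real.pi with hε
  have hε0 : 0 < ε := lt_min (lt_min hε₁ hε₂) Real.pi_pos
  obtain ⟨q, hq, hfar⟩ := exists_pos_le_one_sub_norm_charSeries hj hj' hε0 (min_le_right _ _)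
  set u : ℝ := (1 - 2 * d) / 2 with hu
  have hu0 : 0 < u := by rw [hu]; linarith
  have hu1 : u ≤ 1 / 2 := by rw [hu]; linarith
  set t : ℝ := 1 - u / 2 with ht
  have ht0 : 0 < t := by linarith
  have ht1 : t < 1 := by linarith
  set s : ℝ := (1 - u) / t with hs
  have hs1 : s < 1 := by
    rw [hs, div_lt_one ht0]
    linarith
  have hαt : (γ - 1) * t < γ - 1 := by nlinarith
  have hαt0 : 0 ≤ (γ - 1) * t := mul_nonneg (by linarith) ht0.le
  have hup := norm_one_sub_charSeries_le S hαt0 (by linarith) (summable_moment hS hαt)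
  set K : ℝ := 2 * ∑' j : ℕ, (S j).toReal * (j : ℝ) ^ ((γ - 1) * t) with hK
  have hK0 : 0 ≤ K := mul_nonneg zero_le_two
    (tsum_nonneg fun j => mul_nonneg ENNReal.toReal_nonneg (by positivity))
  clear_value K
  set C₀ : ℝ := k ^ (-u) * (Real.pi * (2 + K / k ^ t)) ^ s with hC₀
  have hC₀0 : 0 ≤ C₀ := by
    have := Real.pi_pos
    positivity
  set p : ℝ := -2 * d + -((γ - 1) * u) with hp
  have hp1 : -1 < p := by
    have : (γ - 1) * u < u := by nlinarith
    rw [hp]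
    linarith
  refine ⟨fun θ => |θ| ^ (-s) * (max M 0 * C₀ * ∫ x in (-Real.pi)..Real.pi, |x| ^ p) +
      (∫ x in (-Real.pi)..Real.pi, f x) * (1 / q),
    ((intervalIntegrable_abs_rpow (by linarith) _ _).mul_const _).add intervalIntegrable_const,
    fun r hr θ hθ hθ0 => ?_⟩
  have hθπ : |θ| ≤ Real.pi := abs_le.2 hθ
  have hpint := intervalIntegrable_abs_rpow hp1 (-Real.pi) Real.pi
  have hA : ∀ x, 1 - ‖charSeries S x‖ ≤ ‖1 - polarPoint r θ * charSeries S x‖ := by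
    intro x
    have h1 := norm_sub_norm_le (1 : ℂ) (polarPoint r θ * charSeries S x)
    rw [norm_one, norm_mul, norm_polarPoint hr.1] at h1
    nlinarith [norm_nonneg (charSeries S x), hr.2]
  have hpt : ∀ x ∈ Set.Icc (-Real.pi) Real.pi, x ≠ 0 →
      ‖(f x : ℂ) * (1 / (1 - polarPoint r θ * charSeries S x))‖ ≤
        |x| ^ p * (max M 0 * C₀ * |θ| ^ (-s)) + f x * (1 / q) := by
    intro x hx hx0
    have hxp : 0 < |x| := abs_pos.2 hx0
    have hfx := hf0 x hx
    rw [norm_mul, norm_div, norm_one, Complex.norm_of_nonneg hfx]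
    rcases lt_or_ge |x| ε with hxε | hxε
    · have hx1 : |x| < ε₁ := hxε.trans_le ((min_le_left _ _).trans (min_le_left _ _))
      have hx2 : |x| < ε₂ := hxε.trans_le ((min_le_left _ _).trans (min_le_right _ _))
      have h1 := one_div_norm_one_sub_le ht0 ht1.le hu0.le (by linarith) hk hK0 hr.1 hr.2.le
        hθπ hθ0 hxp (hlow x hx0 hx1) (hup x)
      have h2 : f x ≤ |x| ^ (-2 * d) * max M 0 := by
        rw [hfφ x hx hx0]
        exact mul_le_mul_of_nonneg_left ((hM x hx2).trans (le_max_left _ _)) (by positivity)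
      have h3 : 0 ≤ f x * (1 / q) := by positivity
      calc f x * (1 / ‖1 - polarPoint r θ * charSeries S x‖)
          ≤ (|x| ^ (-2 * d) * max M 0) * (C₀ * (|x| ^ (-((γ - 1) * u)) * |θ| ^ (-s))) :=
            mul_le_mul h2 h1 (by positivity) (by positivity)
        _ = |x| ^ p * (max M 0 * C₀ * |θ| ^ (-s)) := by
            rw [hp, Real.rpow_add hxp]
            ring
        _ ≤ _ := le_add_of_nonneg_right h3
    · have h1 : 1 / ‖1 - polarPoint r θ * charSeries S x‖ ≤ 1 / q :=
        one_div_le_one_div_of_le hq ((hfar x hx hxε).trans (hA x))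
      have h2 : 0 ≤ |x| ^ p * (max M 0 * C₀ * |θ| ^ (-s)) := by positivity
      exact (mul_le_mul_of_nonneg_left h1 hfx).trans (le_add_of_nonneg_left h2)
  calc ‖resolventIntegral f (charSeries S) (polarPoint r θ)‖
      ≤ ∫ x in (-Real.pi)..Real.pi,
          (|x| ^ p * (max M 0 * C₀ * |θ| ^ (-s)) + f x * (1 / q)) := by
        refine intervalIntegral.norm_integral_le_of_norm_le neg_pi_le_pi ?_
          ((hpint.mul_const _).add (hf.mul_const _))
        filter_upwards [ae_mem_Icc_ne_zero] with x hx hm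
        rw [← Set.uIoc_of_le neg_pi_le_pi] at hm
        exact hpt x (hx hm).1 (hx hm).2
    _ = _ := by
        rw [intervalIntegral.integral_add (hpint.mul_const _) (hf.mul_const _),
          intervalIntegral.integral_mul_const, intervalIntegral.integral_mul_const]
        ring

variable {f : ℝ → ℝ} {σ : ℕ → ℝ} (hf : IntervalIntegrable f volume (-Real.pi) Real.pi)
  (hσ : ∀ j : ℕ, (σ j : ℂ) = ∫ x in (-Real.pi)..Real.pi, (f x : ℂ) * charSeries S x ^ j)

include hf hσ

lemma resolventIntegral_conj {z : ℂ} (hz : ‖z‖ < 1) :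
    resolventIntegral f (charSeries S) ((starRingEnd ℂ) z) =
      (starRingEnd ℂ) (resolventIntegral f (charSeries S) z) := by
  have h1 := hasSum_resolventIntegral hf (continuous_charSeries S) (norm_charSeries_le S) hz
  have h2 := hasSum_resolventIntegral hf (continuous_charSeries S) (norm_charSeries_le S)
    (z := (starRingEnd ℂ) z) (by rwa [RCLike.norm_conj])
  simp only [← hσ] at h1 h2
  have h3 := Complex.hasSum_conj'.2 h1
  simp only [map_mul, map_pow, Complex.conj_ofReal] at h3
  exact h2.unique h3

lemma resolventIntegral_charSeries_neg {z : ℂ} (hz : ‖z‖ < 1) :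
    resolventIntegral f (fun x => charSeries S (-x)) z =
      resolventIntegral f (charSeries S) z := by
  have h1 := hasSum_resolventIntegral hf (continuous_charSeries S) (norm_charSeries_le S) hz
  have h2 := hasSum_resolventIntegral hf (w := fun x => charSeries S (-x))
    ((continuous_charSeries S).comp continuous_neg) (fun x => norm_charSeries_le S (-x)) hz
  have h3 : ∀ j : ℕ, ∫ x in (-Real.pi)..Real.pi, (f x : ℂ) * charSeries S (-x) ^ j = σ j := by
    intro j
    rw [← Complex.conj_ofReal (σ j), hσ j, intervalIntegral.integral_of_le neg_pi_le_pi,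
      intervalIntegral.integral_of_le neg_pi_le_pi, ← integral_conj]
    simp only [map_mul, map_pow, Complex.conj_ofReal, charSeries_neg]
  simp only [h3, ← hσ] at h1 h2
  exact h2.unique h1

lemma oneSidedAbel_eq {r : ℝ} (hr : r ∈ Set.Ico (0 : ℝ) 1) (θ : ℝ) :
    oneSidedAbel f S r θ =
      1 / (2 * (Real.pi : ℂ)) * resolventIntegral f (charSeries S) (polarPoint r θ) := by
  have hz : ‖polarPoint r θ‖ < 1 := by rw [norm_polarPoint hr.1]; exact hr.2
  have hi1 := intervalIntegrable_resolvent hf (continuous_charSeries S) (z := polarPoint r θ)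
    fun x _ => one_sub_mul_ne_zero hz (norm_charSeries_le S x)
  have hi2 := intervalIntegrable_resolvent hf (w := fun x => charSeries S (-x))
    ((continuous_charSeries S).comp continuous_neg) (z := polarPoint r θ)
    fun x _ => one_sub_mul_ne_zero hz (norm_charSeries_le S (-x))
  have h : oneSidedAbel f S r θ = 1 / (4 * (Real.pi : ℂ)) *
      (resolventIntegral f (charSeries S) (polarPoint r θ) +
        resolventIntegral f (fun x => charSeries S (-x)) (polarPoint r θ)) := by
    rw [resolventIntegral, resolventIntegral, ← intervalIntegral.integral_add hi1 hi2]
    simp only [← mul_add]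
    rfl
  rw [h, resolventIntegral_charSeries_neg hf hσ hz]
  have : (Real.pi : ℂ) ≠ 0 := Complex.ofReal_ne_zero.2 Real.pi_ne_zero
  field_simp
  ring

lemma twoSidedAbel_eq {r : ℝ} (hr : r ∈ Set.Ico (0 : ℝ) 1) (θ : ℝ) :
    twoSidedAbel f S r θ =
      ((2 * (1 / (2 * (Real.pi : ℂ)) *
        resolventIntegral f (charSeries S) (polarPoint r θ)).re - σ 0 / (2 * Real.pi) : ℝ) : ℂ) := by
  have hz : ‖polarPoint r θ‖ < 1 := by rw [norm_polarPoint hr.1]; exact hr.2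
  have hz' : ‖(starRingEnd ℂ) (polarPoint r θ)‖ < 1 := by rwa [RCLike.norm_conj]
  have hi1 := intervalIntegrable_resolvent hf (continuous_charSeries S) (z := polarPoint r θ)
    fun x _ => one_sub_mul_ne_zero hz (norm_charSeries_le S x)
  have hi2 := intervalIntegrable_resolvent hf (continuous_charSeries S)
    (z := (starRingEnd ℂ) (polarPoint r θ))
    fun x _ => one_sub_mul_ne_zero hz' (norm_charSeries_le S x)
  have h0 : (σ 0 : ℂ) = ∫ x in (-Real.pi)..Real.pi, (f x : ℂ) := by simpa using hσ 0
  have h : twoSidedAbel f S r θ = 1 / (2 * (Real.pi : ℂ)) *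
      (resolventIntegral f (charSeries S) (polarPoint r θ) +
        resolventIntegral f (charSeries S) ((starRingEnd ℂ) (polarPoint r θ)) - σ 0) := by
    rw [h0, resolventIntegral, resolventIntegral, ← intervalIntegral.integral_add hi1 hi2,
      ← intervalIntegral.integral_sub (hi1.add hi2) (intervalIntegrable_ofReal hf)]
    rw [twoSidedAbel]
    congr 1
    refine intervalIntegral.integral_congr fun x _ => ?_
    simp only [conj_polarPoint]
    rw [polarPoint]
    ring
  rw [h, resolventIntegral_conj hf hσ hz, Complex.add_conj]
  have h2 : (1 / (2 * (Real.pi : ℂ)) *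
      resolventIntegral f (charSeries S) (polarPoint r θ)).re =
      1 / (2 * Real.pi) * (resolventIntegral f (charSeries S) (polarPoint r θ)).re := by
    rw [← Complex.re_ofReal_mul]
    push_cast
    rfl
  rw [h2]
  push_cast
  ring

end

/-- If `G` has Fourier coefficients `σ_n` for `n ≥ 0` and `0` for `n < 0`, then
`2 Re G - σ_0 / 2π` has Fourier coefficients `σ_n` for `n ≥ 0`. -/
lemma integral_exp_mul_two_mul_re {G : ℝ → ℂ} {σ : ℕ → ℝ}
    (hG : IntervalIntegrable G volume (-Real.pi) Real.pi)
    (hc : ∀ n : ℤ, ∫ θ in (-Real.pi)..Real.pi,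
      Complex.exp (Complex.I * (n : ℂ) * (θ : ℂ)) * G θ =
        if 0 ≤ n then (σ n.toNat : ℂ) else 0) (n : ℕ) :
    ∫ θ in (-Real.pi)..Real.pi, Complex.exp (Complex.I * (n : ℂ) * (θ : ℂ)) *
      ((2 * (G θ).re - σ 0 / (2 * Real.pi) : ℝ) : ℂ) = σ n := by
  have hi : ∀ m : ℤ, IntervalIntegrable
      (fun θ : ℝ => Complex.exp (Complex.I * (m : ℂ) * (θ : ℂ)) * G θ) volume
      (-Real.pi) Real.pi := fun m => hG.continuousOn_mul (by fun_prop)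
  have hconj : ∀ θ : ℝ, Complex.exp (Complex.I * ((n : ℤ) : ℂ) * (θ : ℂ)) * (starRingEnd ℂ) (G θ) =
      (starRingEnd ℂ) (Complex.exp (Complex.I * ((-n : ℤ) : ℂ) * (θ : ℂ)) * G θ) := by
    intro θ
    rw [map_mul, ← Complex.exp_conj]
    simp
  have hi' : IntervalIntegrable
      (fun θ : ℝ => Complex.exp (Complex.I * ((n : ℤ) : ℂ) * (θ : ℂ)) * (starRingEnd ℂ) (G θ))
      volume (-Real.pi) Real.pi := by
    simp only [hconj]
    have := hi (-n)
    rw [intervalIntegrable_iff] at this ⊢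
    exact Complex.conjCLE.toContinuousLinearMap.integrable_comp this
  have hval' : ∫ θ in (-Real.pi)..Real.pi,
      Complex.exp (Complex.I * ((n : ℤ) : ℂ) * (θ : ℂ)) * (starRingEnd ℂ) (G θ) =
        if n = 0 then (σ 0 : ℂ) else 0 := by
    simp only [hconj]
    rw [intervalIntegral.integral_of_le neg_pi_le_pi, integral_conj,
      ← intervalIntegral.integral_of_le neg_pi_le_pi, hc]
    rcases Nat.eq_zero_or_pos n with rfl | hn
    · simp
    · rw [if_neg (by omega), if_neg (by omega), map_zero]
  have hsplit : ∀ θ : ℝ, Complex.exp (Complex.I * (n : ℂ) * (θ : ℂ)) *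
      ((2 * (G θ).re - σ 0 / (2 * Real.pi) : ℝ) : ℂ) =
      Complex.exp (Complex.I * ((n : ℤ) : ℂ) * (θ : ℂ)) * G θ +
      Complex.exp (Complex.I * ((n : ℤ) : ℂ) * (θ : ℂ)) * (starRingEnd ℂ) (G θ) -
      Complex.exp (Complex.I * ((n : ℤ) : ℂ) * (θ : ℂ)) * (σ 0 / (2 * Real.pi) : ℂ) := by
    intro θ
    rw [← mul_add, Complex.add_conj]
    push_cast
    ring
  simp only [hsplit]
  rw [intervalIntegral.integral_sub ((hi n).add hi')
      (Continuous.intervalIntegrable (by fun_prop) _ _),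
    intervalIntegral.integral_add (hi n) hi', hc, hval', intervalIntegral.integral_mul_const,
    integral_exp_int_mul, if_pos (Int.natCast_nonneg n), Int.toNat_natCast]
  have hpi : (Real.pi : ℂ) ≠ 0 := Complex.ofReal_ne_zero.2 Real.pi_ne_zero
  rcases Nat.eq_zero_or_pos n with rfl | hn
  · simp only [Nat.cast_zero, if_true]
    field_simp
    ring
  · rw [if_neg (by omega), if_neg (by omega)]
    ring

end RandomSampling

theorem mainTheorem5 {Ω : Type*} [MeasurableSpace Ω] (μ : Measure Ω) [IsProbabilityMeasure μ]
    (X : ℕ → Ω → ℝ) (hXm : ∀ n, Measurable (X n))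
    (fX φ : ℝ → ℝ) (d : ℝ) (hd0 : 0 ≤ d) (hd : d < 1 / 2)
    (hX : RandomSampling.HasSpectralDensity X μ fX)
    (hfX : ∀ x ∈ Set.Icc (-Real.pi) Real.pi, x ≠ 0 → fX x = |x| ^ (-2 * d) * φ x)
    (hφ0 : ∀ x ∈ Set.Icc (-Real.pi) Real.pi, 0 ≤ φ x)
    (hφi : IntervalIntegrable φ volume (-Real.pi) Real.pi)
    (hφb : ∃ ε > 0, ∃ M : ℝ, ∀ x : ℝ, |x| < ε → φ x ≤ M)
    (Δ : ℕ → Ω → ℕ) (S : PMF ℕ) (hΔ : RandomSampling.IsSampling Δ S X μ)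
    (c γ : ℝ) (hc : 0 < c) (hγ1 : 1 < γ) (hγ2 : γ < 2)
    (hS : Asymptotics.IsEquivalent atTop (fun j : ℕ => (S j).toReal)
      (fun j : ℕ => c * (j : ℝ) ^ (-γ))) :
    ∃ (fY : ℝ → ℝ) (G : ℝ → ℂ),
      RandomSampling.HasSpectralDensity
        (RandomSampling.sampled X (RandomSampling.randomWalk Δ)) μ fY ∧
      (∀ θ ∈ Set.Icc (-Real.pi) Real.pi, θ ≠ 0 →
        Tendsto (fun r : ℝ => RandomSampling.twoSidedAbel fX S r θ) (𝓝[<] 1)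
          (𝓝 (fY θ : ℂ))) ∧
      (∀ θ ∈ Set.Icc (-Real.pi) Real.pi, θ ≠ 0 →
        Tendsto (fun r : ℝ => RandomSampling.oneSidedAbel fX S r θ) (𝓝[<] 1) (𝓝 (G θ))) ∧
      IntervalIntegrable G volume (-Real.pi) Real.pi ∧
      (∀ j : ℕ,
        (RandomSampling.covSeq
            (RandomSampling.sampled X (RandomSampling.randomWalk Δ)) μ j : ℂ) =
          ∫ θ in (-Real.pi)..Real.pi,
            Complex.exp (Complex.I * (j : ℂ) * (θ : ℂ)) * G θ) ∧
      (∀ θ ∈ Set.Icc (-Real.pi) Real.pi, θ ≠ 0 →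
        fY θ = 2 * (G θ).re - RandomSampling.covSeq X μ 0 / (2 * Real.pi)) := by
  open RandomSampling in
  set σ : ℕ → ℝ := covSeq (sampled X (randomWalk Δ)) μ with hσdef
  have hσ : ∀ j : ℕ, (σ j : ℂ) = ∫ x in (-Real.pi)..Real.pi, (fX x : ℂ) * charSeries S x ^ j :=
    covSeq_sampled hXm hX hΔ
  have hf := hX.integrable
  have hσ0 : σ 0 = ∫ x in (-Real.pi)..Real.pi, fX x := by
    have h := hσ 0
    simp only [pow_zero, mul_one, intervalIntegral.integral_ofReal] at h
    exact Complex.ofReal_injective h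
  have hσX : covSeq X μ 0 = σ 0 := by
    have h := hX.covSeq_eq 0
    simp only [Nat.cast_zero, mul_zero, zero_mul, Complex.exp_zero, one_mul,
      intervalIntegral.integral_ofReal] at h
    rw [hσ0, Complex.ofReal_injective h]
  have hw := continuous_charSeries S
  have hw1 := norm_charSeries_le S
  obtain ⟨j₀, hj₀, hj₀'⟩ := exists_pos_pair hc hS
  have hne : ∀ θ ∈ Set.Icc (-Real.pi) Real.pi, θ ≠ 0 →
      ∀ x ∈ Set.Icc (-Real.pi) Real.pi, 1 - polarPoint 1 θ * charSeries S x ≠ 0 :=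
    fun θ hθ h0 x hx => one_sub_polarPoint_mul_charSeries_ne_zero hj₀ hj₀' hθ h0 hx
  obtain ⟨D, hD, hbound⟩ := exists_integrable_bound_resolventIntegral hd0 hd hf hX.nonneg hfX hφb
    hc hγ1 hγ2 hS
  have hpi : (Real.pi : ℂ) ≠ 0 := Complex.ofReal_ne_zero.2 Real.pi_ne_zero
  set G : ℝ → ℂ := fun θ =>
    1 / (2 * (Real.pi : ℂ)) * resolventIntegral fX (charSeries S) (polarPoint 1 θ) with hGdef
  have hG : IntervalIntegrable G volume (-Real.pi) Real.pi :=
    (intervalIntegrable_resolventIntegral hf hw hw1 hne hD hbound).const_mul _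
  have hGc : ∀ n : ℤ, ∫ θ in (-Real.pi)..Real.pi,
      Complex.exp (Complex.I * (n : ℂ) * (θ : ℂ)) * G θ =
        if 0 ≤ n then (σ n.toNat : ℂ) else 0 := by
    intro n
    simp only [hGdef, mul_left_comm _ (1 / (2 * (Real.pi : ℂ)))]
    rw [intervalIntegral.integral_const_mul,
      integral_exp_mul_resolventIntegral hf hw hw1 hne hD hbound, ← hσ]
    split_ifs
    · field_simp
    · rw [mul_zero]
  set g : ℝ → ℝ := fun θ => 2 * (G θ).re - σ 0 / (2 * Real.pi) with hgdef
  have hgi : IntervalIntegrable g volume (-Real.pi) Real.pi := by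
    refine IntervalIntegrable.sub (IntervalIntegrable.const_mul ?_ 2) intervalIntegrable_const
    rw [intervalIntegrable_iff] at hG ⊢
    exact hG.re
  have hg0 : ∀ θ ∈ Set.Icc (-Real.pi) Real.pi, θ ≠ 0 → 0 ≤ g θ := by
    intro θ hθ h0
    have h := integral_le_two_mul_re_resolventIntegral hf hw hne hw1 hX.nonneg hθ h0
    have hre : (G θ).re = 1 / (2 * Real.pi) *
        (resolventIntegral fX (charSeries S) (polarPoint 1 θ)).re := by
      rw [← Complex.re_ofReal_mul, hGdef]
      push_cast
      rfl
    have hp := Real.pi_pos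
    rw [← hσ0] at h
    have h2 : g θ = 1 / (2 * Real.pi) *
        (2 * (resolventIntegral fX (charSeries S) (polarPoint 1 θ)).re - σ 0) := by
      simp only [hgdef, hre]
      ring
    rw [h2]
    exact mul_nonneg (by positivity) (by linarith)
  set fY : ℝ → ℝ := fun θ => if θ = 0 then 0 else g θ with hfYdef
  have hfY : ∀ θ, θ ≠ 0 → fY θ = g θ := fun θ h0 => if_neg h0
  have hae : ∀ᵐ θ : ℝ, θ ∈ Set.uIoc (-Real.pi) Real.pi → g θ = fY θ := by
    filter_upwards [ae_mem_Icc_ne_zero] with θ hθ hm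
    exact (hfY θ (hθ hm).2).symm
  have hGlim : ∀ θ ∈ Set.Icc (-Real.pi) Real.pi, θ ≠ 0 →
      Tendsto (fun r => 1 / (2 * (Real.pi : ℂ)) *
        resolventIntegral fX (charSeries S) (polarPoint r θ)) (𝓝[<] 1) (𝓝 (G θ)) :=
    fun θ hθ h0 => (tendsto_resolventIntegral hf hw hw1 hne hθ h0).const_mul _
  refine ⟨fY, G, ⟨sampled_stationary hXm hX hΔ, ?_, ?_, ?_⟩, ?_, ?_, hG, ?_, ?_⟩
  · intro θ hθ
    rcases eq_or_ne θ 0 with h0 | h0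
    · simp [hfYdef, h0]
    · rw [hfY θ h0]
      exact hg0 θ hθ h0
  · refine hgi.congr_ae ?_
    exact (ae_restrict_iff' measurableSet_uIoc).2 hae
  · intro h
    rw [← hσdef, ← integral_exp_mul_two_mul_re hG hGc h]
    refine intervalIntegral.integral_congr_ae ?_
    filter_upwards [hae] with θ hθ hm
    rw [← hθ hm]
  · intro θ hθ h0
    rw [hfY θ h0]
    have h1 : Tendsto (fun r => ((2 * (1 / (2 * (Real.pi : ℂ)) *
        resolventIntegral fX (charSeries S) (polarPoint r θ)).re - σ 0 / (2 * Real.pi) : ℝ) : ℂ))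
        (𝓝[<] 1) (𝓝 (g θ : ℂ)) :=
      (Complex.continuous_ofReal.tendsto _).comp
        ((((Complex.continuous_re.tendsto _).comp (hGlim θ hθ h0)).const_mul 2).sub_const _)
    refine h1.congr' ?_
    filter_upwards [eventually_mem_Ico_zero_one] with r hr
    exact (twoSidedAbel_eq hf hσ hr θ).symm
  · intro θ hθ h0
    refine (hGlim θ hθ h0).congr' ?_
    filter_upwards [eventually_mem_Ico_zero_one] with r hr
    exact (oneSidedAbel_eq hf hσ hr θ).symm
  · intro j
    have h := hGc j
    rw [if_pos (Int.natCast_nonneg j), Int.toNat_natCast] at h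
    rw [← h]
    simp only [Int.cast_natCast]
  · intro θ _ h0
    rw [hfY θ h0, hσX]
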